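/- **Conventions.** All spaces are Hausdorff. For $S\subset E$ and $\varepsilon>0$ let $\mathbf{O}_\varepsilon(S)=\{z\in E:\|z-y\|<\varepsilon\text{ for some }y\in S\}$, and $\mathbf{O}_\varepsilon(y)=\mathbf{O}_\varepsilon(\{y\})$. Let $\mathbb{S}^k$ and $\mathbb{B}^{k+1}$ be the unit sphere and the closed unit ball of $\mathbb{R}^{k+1}$; in particular $\mathbb{S}^{-1}=\emptyset$ and $\mathbb{B}^0$ is a point. For an integer $n\ge -1$, a family $\mathscr{S}$ of subsets of a metric space is *uniformly equi-$LC^n$* if for every $\varepsilon>0$ there is $\delta>0$ such that for every $S\in\mathscr{S}$ and every integer $-1\le k\le n$, every continuous map $\mathbb{S}^k\to S$ whose image has diameter $<\delta$ extends to a continuous map $\mathbb{B}^{k+1}\to S$ whose image has diameter $<\varepsilon$. (The case $k=-1$ says that all members of $\mathscr{S}$ are nonempty.) For a normal space $X$, $\dim(X)\le m$ means that every finite open cover of $X$ has a refinement by an open cover in which any $m+2$ distinct members have empty intersection. A map $\Phi:X\to\mathscr{S}$ is *l.s.c.* if $\{x\in X:\Phi(x)\cap U\ne\emptyset\}$ is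 open for every open $U\subset E$. **Theorem.** Let $n\ge -1$ be an integer, let $E$ be a Banach space and let $\mathscr{S}$ be a uniformly equi-$LC^n$ family of subsets of $E$. Then there is a function $\gamma:(0,+\infty)\to(0,+\infty)$ with the following property: whenever $X$ is a paracompact Hausdorff space with $\dim(X)\le n+1$, $\Phi:X\to\mathscr{S}$ is l.s.c., $\varepsilon>0$, and $g:X\to E$ is a continuous map with $g(x)\in\mathbf{O}_{\gamma(\varepsilon)}(\Phi(x))$ for all $x\in X$, there is a continuous map $f:X\to E$ with $f(x)\in\overline{\Phi(x)}\cap\mathbf{O}_\varepsilon(g(x))$ for all $x\in X$. -/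

import Mathlib

open Set Metric

/-- The order of a family `𝒱` of subsets of `X` does not exceed `n`: any (finite) subfamily with at
least `n + 2` members has empty intersection. -/
def CoverOrderLE {X : Type*} (𝒱 : Set (Set X)) (n : ℤ) : Prop :=
  ∀ σ : Finset (Set X), (σ : Set (Set X)) ⊆ 𝒱 → n + 2 ≤ (σ.card : ℤ) →
    ⋂₀ (σ : Set (Set X)) = ∅

/-- The (Lebesgue) covering dimension of `X` is at most `n`: every finite open cover of `X` has an
open refinement that covers `X` and whose order does not exceed `n`. -/
def CoveringDimLE (X : Type*) [TopologicalSpace X] (n : ℤ) : Prop :=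
  ∀ 𝒰 : Set (Set X), 𝒰.Finite → (∀ U ∈ 𝒰, IsOpen U) → ⋃₀ 𝒰 = univ →
    ∃ 𝒱 : Set (Set X), (∀ V ∈ 𝒱, IsOpen V) ∧ ⋃₀ 𝒱 = univ ∧
      (∀ V ∈ 𝒱, ∃ U ∈ 𝒰, V ⊆ U) ∧ CoverOrderLE 𝒱 n

/-- A family `𝒮` of subsets of a metric space is uniformly equi-`LC^n`: for every `ε > 0` there is
`δ > 0` such that, for every `S ∈ 𝒮` and every `k ≤ n`, each continuous map of the `k`-sphere into
`S` with image of diameter `< δ` extends to a continuous map of the `(k+1)`-ball into `S` with image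
of diameter `< ε`. Here `m = k + 1` runs over the natural numbers up to `n + 1`, the `k`-sphere and
the `(k+1)`-ball being the unit sphere and the closed unit ball of `ℝ^m`. The case `m = 0` (empty
sphere, one-point ball) says exactly that the members of `𝒮` are nonempty. All images are compact,
so `Metric.diam` is their true diameter. -/
def UniformlyEquiLC {Y : Type*} [MetricSpace Y] (n : ℤ) (𝒮 : Set (Set Y)) : Prop :=
  ∀ ε : ℝ, 0 < ε → ∃ δ : ℝ, 0 < δ ∧ ∀ S ∈ 𝒮, ∀ m : ℕ, (m : ℤ) ≤ n + 1 →
    ∀ f : C(sphere (0 : EuclideanSpace ℝ (Fin m)) 1, S),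
      diam (range fun x => (f x : Y)) < δ →
      ∃ h : C(closedBall (0 : EuclideanSpace ℝ (Fin m)) 1, S),
        (∀ x : sphere (0 : EuclideanSpace ℝ (Fin m)) 1,
          h ⟨x, sphere_subset_closedBall x.2⟩ = f x) ∧
        diam (range fun x => (h x : Y)) < ε

/-- `f` is a selection for the set-valued mapping `Φ`. -/
def IsSelection {X Y : Type*} (f : X → Y) (Φ : X → Set Y) : Prop :=
  ∀ x, f x ∈ Φ x

/-- `f` is an `ε`-selection for `Φ`: each `f x` lies in the open `ε`-neighbourhood of `Φ x`. -/
def IsEpsSelection {X Y : Type*} [MetricSpace Y] (ε : ℝ) (f : X → Y) (Φ : X → Set Y) : Prop :=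
  ∀ x, f x ∈ thickening ε (Φ x)

/-!
The selection is a uniform limit of approximate selections. Everything rests on
`UniformlyEquiLC.exists_improved_selection`: a `δ`-selection can be moved by less than `ε` to
become a `μ`-selection, where `δ` depends on `ε` but not on `μ`. Iterating it with geometrically
decreasing `ε` gives a uniformly convergent sequence whose limit takes values in the closures.

The improvement is obtained from `exists_continuous_selection`, a selection theorem for an
increasing sequence `Ψ 0, …, Ψ N` of set-valued maps with open graphs on a paracompact space of
dimension at most `N`, in which every `k`-sphere in `Ψ k x` bounds a `(k+1)`-ball in
`Ψ (k + 1) x`. Its proof constructs, by induction on `k`, a cover and a map of the `k`-skeleton of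
the nerve of the cover that sends each simplex into `Ψ k x` for all `x` in the intersection of the
vertices (`IsSkeletalSelection`). To extend over the `(k+1)`-simplices the cover has to be refined.
At `k = N` the dimension of `X` allows one to map `X` into the `N`-skeleton by a partition of
unity. This takes a cover of order at most `N` refining an infinite cover, whereas covering
dimension speaks of finite covers only; the passage is Dowker's theorem
(`CoveringDimLE.hasShrinkingsOfOrderLE`).

The sequence used is `Ψ k x = thickening (ν k) (Φ x) ∩ ball (g x) (R k)`, with the `R k` chosen
first and the `ν k` afterwards, both backwards from `k = N`. That spheres in one of these sets
bound balls in the next is `UniformlyEquiLC.exists_sphereExtends_thickening`. There a sphere near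
`S ∈ 𝒮` has first to be approximated by a sphere in `S`. The approximation is another instance of
`exists_continuous_selection`, now on the sphere itself, with the balls of `S` as the sets `Ψ k x`;
so the dimension of spheres is needed too (`hasShrinkingsOfOrderLE_sphere`).
-/

/-! ### Covering dimension and infinite covers -/

/-- The indexed family `W` has order at most `N`: every point lies in at most `N + 1` members
(counted with their indices). -/
def FamilyOrderLE {ι X : Type*} (W : ι → Set X) (N : ℕ) : Prop :=
  ∀ x, ∀ σ : Finset ι, (∀ i ∈ σ, x ∈ W i) → σ.card ≤ N + 1

/-- Every open cover of `X`, finite or not, has a locally finite open shrinking of order at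
most `N`. The index types range over the universe of `X`, which is all that is needed for
covers indexed by points of `X`. -/
def HasShrinkingsOfOrderLE.{u} (X : Type u) [TopologicalSpace X] (N : ℕ) : Prop :=
  ∀ (ι : Type u) (V : ι → Set X), (∀ i, IsOpen (V i)) → ⋃ i, V i = univ →
    ∃ W : ι → Set X, (∀ i, IsOpen (W i)) ∧ ⋃ i, W i = univ ∧ (∀ i, W i ⊆ V i) ∧
      LocallyFinite W ∧ FamilyOrderLE W N

theorem CoveringDimLE.exists_shrinking_of_finite {X ι : Type*} [TopologicalSpace X] [Finite ι]
    {N : ℕ} (h : CoveringDimLE X N) (U : ι → Set X) (hU : ∀ i, IsOpen (U i))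
    (hc : ⋃ i, U i = univ) :
    ∃ W : ι → Set X, (∀ i, IsOpen (W i)) ∧ ⋃ i, W i = univ ∧ (∀ i, W i ⊆ U i) ∧
      FamilyOrderLE W N := by
  classical
  obtain ⟨𝒱, hopen, hcov, href, hord⟩ := h (range U) (finite_range U)
    (by rintro _ ⟨i, rfl⟩; exact hU i) (by rwa [sUnion_range])
  have href' : ∀ V : 𝒱, ∃ i, (V : Set X) ⊆ U i := by
    rintro ⟨V, hV⟩
    obtain ⟨_, ⟨i, rfl⟩, hi⟩ := href V hV
    exact ⟨i, hi⟩
  choose c hcU using href'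
  refine ⟨fun i => ⋃ V : {V : 𝒱 // c V = i}, (V.1 : Set X), fun i => ?_, ?_, fun i => ?_, ?_⟩
  · exact isOpen_iUnion fun V => hopen _ V.1.2
  · refine eq_univ_of_forall fun x => ?_
    obtain ⟨V, hV, hx⟩ := (hcov ▸ mem_univ x : x ∈ ⋃₀ 𝒱)
    exact mem_iUnion.2 ⟨c ⟨V, hV⟩, mem_iUnion.2 ⟨⟨⟨V, hV⟩, rfl⟩, hx⟩⟩
  · exact iUnion_subset fun V => (hcU V.1).trans (by rw [V.2])
  · intro x σ hσ
    have hx : ∀ i : σ, ∃ V : 𝒱, c V = i ∧ x ∈ (V : Set X) := by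
      rintro ⟨i, hi⟩
      obtain ⟨V, hV⟩ := mem_iUnion.1 (hσ i hi)
      exact ⟨V.1, V.2, hV⟩
    choose v hvc hvx using hx
    have hinj : Function.Injective fun i : σ => (v i : Set X) := by
      intro i j hij
      have : v i = v j := Subtype.ext hij
      exact Subtype.ext (by rw [← hvc i, ← hvc j, this])
    by_contra hlt
    have hemp := hord (Finset.univ.image fun i : σ => (v i : Set X))
      (by intro V hV
          simp only [Finset.coe_image, Finset.coe_univ, image_univ] at hV
          obtain ⟨i, rfl⟩ := hV
          exact (v i).2)
      (by rw [Finset.card_image_of_injective _ hinj, Finset.card_univ, Fintype.card_coe]; omega)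
    have : x ∈ ⋂₀ ((Finset.univ.image fun i : σ => (v i : Set X) : Finset (Set X)) :
        Set (Set X)) := by
      intro V hV
      simp only [Finset.coe_image, Finset.coe_univ, image_univ] at hV
      obtain ⟨i, rfl⟩ := hV
      exact hvx i
    rw [hemp] at this
    exact this

/-- A locally finite closed cover of order at most `N` that is contained, member by member, in an
open family swells to an open cover of order at most `N` contained in that family: the swollen
members are the stars of the closed ones with respect to a fine enough closed cover. -/
theorem exists_open_swelling {X ι : Type*} [TopologicalSpace X] [T2Space X] [ParacompactSpace X]
    {N : ℕ} (F U : ι → Set X) (hF : ∀ i, IsClosed (F i)) (hlf : LocallyFinite F)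
    (hU : ∀ i, IsOpen (U i)) (hFU : ∀ i, F i ⊆ U i) (hc : ⋃ i, F i = univ)
    (hord : FamilyOrderLE F N) :
    ∃ W : ι → Set X, (∀ i, IsOpen (W i)) ∧ ⋃ i, W i = univ ∧ (∀ i, W i ⊆ U i) ∧
      FamilyOrderLE W N := by
  -- the neighbourhood `O x` of `x` meets only those `F i` that contain `x`
  let O : X → Set X := fun x => (⋃ i : {i // x ∉ F i}, F i)ᶜ
  have hO : ∀ x, IsOpen (O x) := fun x =>
    ((hlf.comp_injective Subtype.val_injective).isClosed_iUnion fun i => hF i.1).isOpen_compl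
  have hxO : ∀ x, x ∈ O x := fun x hx => by
    obtain ⟨i, hi⟩ := mem_iUnion.1 hx
    exact i.2 hi
  obtain ⟨V, hVo, hVc, hVlf, hVO⟩ := precise_refinement O hO
    (eq_univ_of_forall fun x => mem_iUnion.2 ⟨x, hxO x⟩)
  obtain ⟨C, hCc, hCcl, hCV⟩ :=
    exists_iUnion_eq_closed_subset hVo (fun x => hVlf.point_finite x) hVc
  have hClf : LocallyFinite C := hVlf.subset hCV
  refine ⟨fun i => (⋃ a : {a // C a ∩ F i = ∅}, C a)ᶜ ∩ U i, fun i => ?_, ?_,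
    fun i => inter_subset_right, ?_⟩
  · exact ((hClf.comp_injective Subtype.val_injective).isClosed_iUnion
      fun a => hCcl a.1).isOpen_compl.inter (hU i)
  · refine eq_univ_of_forall fun x => ?_
    obtain ⟨i, hi⟩ := mem_iUnion.1 (hc ▸ mem_univ x : x ∈ ⋃ i, F i)
    refine mem_iUnion.2 ⟨i, fun hx => ?_, hFU i hi⟩
    obtain ⟨a, ha⟩ := mem_iUnion.1 hx
    exact (a.2 ▸ (⟨ha, hi⟩ : x ∈ C a ∩ F i) : x ∈ (∅ : Set X))
  · intro x σ hσ
    obtain ⟨a, ha⟩ := mem_iUnion.1 (hCc ▸ mem_univ x : x ∈ ⋃ i, C i)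
    refine hord a σ fun i hi => ?_
    have hne : (C a ∩ F i).Nonempty := by
      by_contra hemp
      exact (hσ i hi).1 (mem_iUnion.2 ⟨⟨a, not_nonempty_iff_eq_empty.1 hemp⟩, ha⟩)
    obtain ⟨z, hzC, hzF⟩ := hne
    by_contra hai
    exact hVO a (hCV a hzC) (mem_iUnion.2 ⟨⟨i, hai⟩, hzF⟩)

theorem CoveringDimLE.exists_shrinking_initial {X : Type*} [TopologicalSpace X] [NormalSpace X]
    {N : ℕ} (h : CoveringDimLE X N) (G : ℕ → Set X) (hG : ∀ j, IsOpen (G j))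
    (hc : ⋃ j, G j = univ) (hlf : LocallyFinite G) (m : ℕ) :
    ∃ G' : ℕ → Set X, (∀ j, IsOpen (G' j)) ∧ ⋃ j, G' j = univ ∧ (∀ j, closure (G' j) ⊆ G j) ∧
      ∀ x, ∀ σ : Finset ℕ, (∀ j ∈ σ, j < m) → (∀ j ∈ σ, x ∈ closure (G' j)) →
        σ.card ≤ N + 1 := by
  classical
  -- all the members from the `m`-th on are merged into one, the member `none`
  let U : Option (Fin m) → Set X := fun o => o.elim (⋃ j : {j // m ≤ j}, G j) fun i => G i
  obtain ⟨W, hWo, hWc, hWU, hWord⟩ := h.exists_shrinking_of_finite U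
    (by rintro (_ | i)
        · exact isOpen_iUnion fun j => hG _
        · exact hG _)
    (by refine eq_univ_of_forall fun x => ?_
        obtain ⟨j, hj⟩ := mem_iUnion.1 (hc ▸ mem_univ x : x ∈ ⋃ i, G i)
        rcases lt_or_ge j m with hjm | hjm
        · exact mem_iUnion.2 ⟨some ⟨j, hjm⟩, hj⟩
        · exact mem_iUnion.2 ⟨none, mem_iUnion.2 ⟨⟨j, hjm⟩, hj⟩⟩)
  let G₁ : ℕ → Set X := fun j => if hj : j < m then W (some ⟨j, hj⟩) else G j ∩ W none
  have hlt : ∀ {j} (hj : j < m), G₁ j = W (some ⟨j, hj⟩) := fun hj => dif_pos hj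
  have hge : ∀ {j}, m ≤ j → G₁ j = G j ∩ W none := fun hj => dif_neg hj.not_gt
  have hG₁G : ∀ j, G₁ j ⊆ G j := by
    intro j
    rcases lt_or_ge j m with hj | hj
    · rw [hlt hj]; exact hWU (some ⟨j, hj⟩)
    · rw [hge hj]; exact inter_subset_left
  obtain ⟨G', hG'c, hG'o, hG'G⟩ := exists_iUnion_eq_closure_subset (u := G₁)
    (fun j => by
      rcases lt_or_ge j m with hj | hj
      · rw [hlt hj]; exact hWo _
      · rw [hge hj]; exact (hG j).inter (hWo _))
    (fun x => (hlf.point_finite x).subset fun j hj => hG₁G j hj)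
    (by refine eq_univ_of_forall fun x => ?_
        obtain ⟨o, ho⟩ := mem_iUnion.1 (hWc ▸ mem_univ x : x ∈ ⋃ i, W i)
        rcases o with _ | i
        · obtain ⟨j, hj⟩ := mem_iUnion.1 (hWU _ ho)
          exact mem_iUnion.2 ⟨j, by rw [hge j.2]; exact ⟨hj, ho⟩⟩
        · exact mem_iUnion.2 ⟨i, by rw [hlt i.2]; exact ho⟩)
  refine ⟨G', hG'o, hG'c, fun j => (hG'G j).trans (hG₁G j), fun x σ hσ hx => ?_⟩
  have := hWord x (σ.attach.image fun j => some ⟨j.1, hσ j.1 j.2⟩) (by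
    intro o ho
    obtain ⟨j, -, rfl⟩ := Finset.mem_image.1 ho
    rw [← hlt]
    exact hG'G _ (hx j.1 j.2))
  rwa [Finset.card_image_of_injective, Finset.card_attach] at this
  intro i j hij
  exact Subtype.ext (congrArg Fin.val (Option.some_injective _ hij))

/-- Countable covers: shrink so that the first `m` members have order at most `N`, for
`m = 0, 1, 2, …` in turn, with closures nested. The closed sets that remain still cover, because
the original cover is locally finite, and have order at most `N`. -/
theorem CoveringDimLE.exists_shrinking_of_nat {X : Type*} [TopologicalSpace X] [T2Space X]
    [ParacompactSpace X] {N : ℕ} (h : CoveringDimLE X N) (G : ℕ → Set X)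
    (hG : ∀ j, IsOpen (G j)) (hc : ⋃ j, G j = univ) (hlf : LocallyFinite G) :
    ∃ W : ℕ → Set X, (∀ j, IsOpen (W j)) ∧ ⋃ j, W j = univ ∧ (∀ j, W j ⊆ G j) ∧
      FamilyOrderLE W N := by
  classical
  let S := {G : ℕ → Set X // (∀ j, IsOpen (G j)) ∧ ⋃ j, G j = univ ∧ LocallyFinite G}
  have step : ∀ (m : ℕ) (G : S), ∃ G' : S, (∀ j, closure (G'.1 j) ⊆ G.1 j) ∧
      ∀ x, ∀ σ : Finset ℕ, (∀ j ∈ σ, j < m) → (∀ j ∈ σ, x ∈ closure (G'.1 j)) →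
        σ.card ≤ N + 1 := by
    rintro m ⟨G, hG, hc, hlf⟩
    obtain ⟨G', h1, h2, h3, h4⟩ := h.exists_shrinking_initial G hG hc hlf m
    exact ⟨⟨G', h1, h2, hlf.subset fun j => subset_closure.trans (h3 j)⟩, h3, h4⟩
  choose next hnext hnord using step
  let H : ℕ → S := fun m => Nat.rec ⟨G, hG, hc, hlf⟩ (fun m G => next m G) m
  have hsucc : ∀ m j, closure ((H (m + 1)).1 j) ⊆ (H m).1 j := fun m j => hnext m (H m) j
  have hanti : ∀ j, Antitone fun m => (H m).1 j := fun j =>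
    antitone_nat_of_succ_le fun m => subset_closure.trans (hsucc m j)
  let F : ℕ → Set X := fun j => ⋂ m, closure ((H (m + 1)).1 j)
  have hFG : ∀ j, F j ⊆ G j := fun j => (iInter_subset _ 0).trans (hsucc 0 j)
  refine exists_open_swelling F G (fun j => isClosed_iInter fun m => isClosed_closure)
    (hlf.subset hFG) hG hFG ?_ ?_
  · refine eq_univ_of_forall fun x => ?_
    -- some index `j` occurs for infinitely many `m`
    have hx : ∀ m, ∃ j, x ∈ (H m).1 j := fun m =>
      mem_iUnion.1 (by rw [(H m).2.2.1]; exact mem_univ x)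
    choose j hj using hx
    have hfin : {i | x ∈ G i}.Finite := hlf.point_finite x
    have : Finite {i | x ∈ G i} := hfin
    obtain ⟨i, hi⟩ := Finite.exists_infinite_fiber
      fun m => (⟨j m, hanti (j m) (Nat.zero_le m) (hj m)⟩ : {i | x ∈ G i})
    refine mem_iUnion.2 ⟨i, mem_iInter.2 fun m => subset_closure ?_⟩
    obtain ⟨m', hm', hlt⟩ := (infinite_coe_iff.1 hi).exists_gt (m + 1)
    have hji : j m' = i := congrArg Subtype.val hm'
    exact hanti i hlt.le (hji ▸ hj m')
  · intro x σ hσ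
    obtain ⟨m, hm⟩ := σ.exists_nat_subset_range
    refine hnord m (H m) x σ (fun j hj => Finset.mem_range.1 (hm hj)) fun j hj => ?_
    exact mem_iInter.1 (hσ j hj) m

/-- **Dowker's theorem.** A paracompact space whose finite open covers have open refinements of
order at most `N` has the same property for arbitrary open covers. A cover with partition of
unity `φ` is replaced by the countable cover whose `k`-th member is the disjoint union, over
the `k`-element sets `T` of indices, of the sets on which the functions `φ s`, `s ∈ T`, are the
`k` largest. -/
theorem CoveringDimLE.hasShrinkingsOfOrderLE {X : Type*} [TopologicalSpace X] [T2Space X]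
    [ParacompactSpace X] {N : ℕ} (h : CoveringDimLE X N) : HasShrinkingsOfOrderLE X N := by
  classical
  intro ι V₀ hV₀ hc₀
  obtain ⟨V, hVo, hVc, hVlf, hVV₀⟩ := precise_refinement V₀ hV₀ hc₀
  obtain ⟨φ, hφ⟩ := PartitionOfUnity.exists_isSubordinate_of_locallyFinite isClosed_univ V hVo hVlf
    hVc.ge
  have hφV : ∀ s x, 0 < φ s x → x ∈ V s := fun s x hx =>
    hφ s (subset_tsupport _ (Function.mem_support.2 hx.ne'))
  let W : Finset ι → Set X := fun T =>
    {x | (∀ s ∈ T, 0 < φ s x) ∧ ∀ s ∈ T, ∀ s' ∉ T, φ s' x < φ s x}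
  have hWo : ∀ T, IsOpen (W T) := by
    intro T
    rw [isOpen_iff_mem_nhds]
    rintro x ⟨hx1, hx2⟩
    obtain ⟨U, hU, hUfin⟩ := φ.locallyFinite x
    have h1 : ∀ᶠ y in nhds x, ∀ s ∈ T, 0 < φ s y :=
      (Filter.eventually_all_finset T).2 fun s hs =>
        (φ s).continuous.continuousAt.eventually (lt_mem_nhds (hx1 s hs))
    have h2 : ∀ᶠ y in nhds x, ∀ s ∈ T, ∀ s' ∈ hUfin.toFinset, s' ∉ T → φ s' y < φ s y :=
      (Filter.eventually_all_finset T).2 fun s hs =>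
        (Filter.eventually_all_finset _).2 fun s' _ => by
          by_cases hs' : s' ∈ T
          · exact Filter.Eventually.of_forall fun y hy => absurd hs' hy
          · filter_upwards [(φ s').continuous.continuousAt.eventually_lt
              (φ s).continuous.continuousAt (hx2 s hs s' hs')] with y hy _ using hy
    filter_upwards [h1, h2, hU] with y hy1 hy2 hyU
    refine ⟨hy1, fun s hs s' hs' => ?_⟩
    by_cases hfin : s' ∈ hUfin.toFinset
    · exact hy2 s hs s' hfin hs'
    · have : φ s' y = 0 := by
        by_contra hne
        exact hfin (hUfin.mem_toFinset.2 ⟨y, Function.mem_support.2 hne, hyU⟩)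
      rw [this]
      exact hy1 s hs
  have hdisj : ∀ T T' x, x ∈ W T → x ∈ W T' → T.card = T'.card → T = T' := by
    intro T T' x hx hx' hcard
    by_contra hne
    obtain ⟨s, hs, hs'⟩ := Finset.not_subset.1
      fun hsub => hne (Finset.eq_of_subset_of_card_le hsub hcard.ge)
    obtain ⟨t, ht, ht'⟩ := Finset.not_subset.1
      fun hsub => hne (Finset.eq_of_subset_of_card_le hsub hcard.le).symm
    exact lt_asymm (hx.2 s hs t ht') (hx'.2 t ht s hs')
  have hcov : ∀ x, ∃ T, T.Nonempty ∧ x ∈ W T := by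
    intro x
    have hfin : {s | 0 < φ s x}.Finite := (hVlf.point_finite x).subset fun s hs => hφV s x hs
    have hne : hfin.toFinset.Nonempty := by
      obtain ⟨s, hs⟩ := φ.exists_pos (mem_univ x)
      exact ⟨s, hfin.mem_toFinset.2 hs⟩
    refine ⟨hfin.toFinset, hne, fun s hs => hfin.mem_toFinset.1 hs, fun s hs s' hs' => ?_⟩
    have : ¬ 0 < φ s' x := fun hlt => hs' (hfin.mem_toFinset.2 hlt)
    exact (not_lt.1 this).trans_lt (hfin.mem_toFinset.1 hs)
  let G : ℕ → Set X := fun k => ⋃ T : {T : Finset ι // T.Nonempty ∧ T.card = k}, W T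
  have hGlf : LocallyFinite G := by
    intro x
    obtain ⟨U, hU, hUfin⟩ := hVlf x
    refine ⟨U, hU, (finite_Iic hUfin.toFinset.card).subset ?_⟩
    rintro k ⟨y, hyG, hyU⟩
    obtain ⟨⟨T, hT, rfl⟩, hyT⟩ := mem_iUnion.1 hyG
    exact Finset.card_le_card fun s hs => hUfin.mem_toFinset.2 ⟨y, hφV s y (hyT.1 s hs), hyU⟩
  obtain ⟨H, hHo, hHc, hHG, hHord⟩ := h.exists_shrinking_of_nat G
    (fun k => isOpen_iUnion fun T => hWo _)
    (eq_univ_of_forall fun x => by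
      obtain ⟨T, hT, hx⟩ := hcov x
      exact mem_iUnion.2 ⟨T.card, mem_iUnion.2 ⟨⟨T, hT, rfl⟩, hx⟩⟩) hGlf
  let Q : ι → Set X := fun s => ⋃ T : {T : Finset ι // ∃ hT : T.Nonempty, hT.choose = s},
    H T.1.card ∩ W T
  have hQV : ∀ s, Q s ⊆ V s := by
    intro s x hx
    obtain ⟨⟨T, hT, hTs⟩, -, hxT⟩ := mem_iUnion.1 hx
    exact hφV s x (hxT.1 s (hTs ▸ hT.choose_spec))
  refine ⟨Q, fun s => isOpen_iUnion fun T => (hHo _).inter (hWo _), ?_,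
    fun s => (hQV s).trans (hVV₀ s), hVlf.subset hQV, ?_⟩
  · refine eq_univ_of_forall fun x => ?_
    obtain ⟨k, hk⟩ := mem_iUnion.1 (hHc ▸ mem_univ x : x ∈ ⋃ k, H k)
    obtain ⟨⟨T, hT, rfl⟩, hxT⟩ := mem_iUnion.1 (hHG k hk)
    exact mem_iUnion.2 ⟨hT.choose, mem_iUnion.2 ⟨⟨T, hT, rfl⟩, hk, hxT⟩⟩
  · intro x σ hσ
    have hx : ∀ s : σ, ∃ T : Finset ι, (∃ hT : T.Nonempty, hT.choose = s) ∧ x ∈ H T.card ∧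
        x ∈ W T := by
      rintro ⟨s, hs⟩
      obtain ⟨T, hTH, hTW⟩ := mem_iUnion.1 (hσ s hs)
      exact ⟨T.1, T.2, hTH, hTW⟩
    choose T hTs hTH hTW using hx
    have hinj : Function.Injective fun s : σ => (T s).card := by
      intro s t hst
      have hTT := hdisj _ _ x (hTW s) (hTW t) hst
      obtain ⟨h1, h1'⟩ := hTs s
      obtain ⟨h2, h2'⟩ := hTs t
      refine Subtype.ext (h1'.symm.trans (Eq.trans ?_ h2'))
      congr 1
      rw [hTT]
    have := hHord x (Finset.univ.image fun s : σ => (T s).card) (by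
      intro k hk
      obtain ⟨s, -, rfl⟩ := Finset.mem_image.1 hk
      exact hTH s)
    rwa [Finset.card_image_of_injective _ hinj, Finset.card_univ, Fintype.card_coe] at this

/-! ### Geometric simplices -/

/-- The geometric simplex with vertex set `σ`, in barycentric coordinates. All simplices on
vertices from `ι` live in the one space `ι → ℝ`, with the product topology. -/
def simplexOn {ι : Type*} (σ : Finset ι) : Set (ι → ℝ) :=
  {t | (∀ i, 0 ≤ t i) ∧ (∀ i ∉ σ, t i = 0) ∧ ∑ i ∈ σ, t i = 1}

theorem isClosed_simplexOn {ι : Type*} (σ : Finset ι) : IsClosed (simplexOn σ) := by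
  have h1 : IsClosed {t : ι → ℝ | ∀ i, 0 ≤ t i} := by
    rw [ofPred_forall]
    exact isClosed_iInter fun i => isClosed_le continuous_const (continuous_apply i)
  have h2 : IsClosed {t : ι → ℝ | ∀ i ∉ σ, t i = 0} := by
    simp only [ofPred_forall]
    exact isClosed_iInter fun i => isClosed_iInter fun _ =>
      isClosed_eq (continuous_apply i) continuous_const
  have h3 : IsClosed {t : ι → ℝ | ∑ i ∈ σ, t i = 1} :=
    isClosed_eq (continuous_finsetSum _ fun i _ => continuous_apply i) continuous_const
  exact h1.inter (h2.inter h3)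

theorem isCompact_simplexOn {ι : Type*} (σ : Finset ι) : IsCompact (simplexOn σ) := by
  refine (isCompact_univ_pi fun _ : ι => isCompact_Icc (a := (0 : ℝ)) (b := 1)).of_isClosed_subset
    (isClosed_simplexOn σ) fun t ht i _ => ⟨ht.1 i, ?_⟩
  by_cases hi : i ∈ σ
  · exact ht.2.2 ▸ Finset.single_le_sum (f := t) (fun j _ => ht.1 j) hi
  · rw [ht.2.1 i hi]; exact zero_le_one

theorem simplexOn_erase {ι : Type*} [DecidableEq ι] {σ : Finset ι} {t : ι → ℝ} {i : ι}
    (ht : t ∈ simplexOn σ) (hi : t i = 0) : t ∈ simplexOn (σ.erase i) := by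
  refine ⟨ht.1, fun j hj => ?_, ?_⟩
  · by_cases hji : j = i
    · rw [hji, hi]
    · exact ht.2.1 j fun hjσ => hj (Finset.mem_erase.2 ⟨hji, hjσ⟩)
  · rw [Finset.sum_erase _ hi, ht.2.2]

/-- The standard full-dimensional simplex in Euclidean space. -/
def cornerSimplex (m : ℕ) : Set (EuclideanSpace ℝ (Fin m)) :=
  {w | (∀ j, 0 ≤ w j) ∧ ∑ j, w j ≤ 1}

theorem isClosed_cornerSimplex (m : ℕ) : IsClosed (cornerSimplex m) := by
  have h1 : IsClosed {w : EuclideanSpace ℝ (Fin m) | ∀ j, 0 ≤ w j} := by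
    rw [ofPred_forall]
    exact isClosed_iInter fun i => isClosed_le continuous_const (by fun_prop)
  have h2 : IsClosed {w : EuclideanSpace ℝ (Fin m) | ∑ j, w j ≤ 1} :=
    isClosed_le (by fun_prop) continuous_const
  exact h1.inter h2

theorem convex_cornerSimplex (m : ℕ) : Convex ℝ (cornerSimplex m) := by
  intro x hx y hy a b ha hb hab
  refine ⟨fun j => ?_, ?_⟩
  · have := hx.1 j
    have := hy.1 j
    simp only [PiLp.add_apply, PiLp.smul_apply, smul_eq_mul]
    positivity
  · simp only [PiLp.add_apply, PiLp.smul_apply, smul_eq_mul, Finset.sum_add_distrib,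
      ← Finset.mul_sum]
    nlinarith [hx.2, hy.2]

theorem isBounded_cornerSimplex (m : ℕ) : Bornology.IsBounded (cornerSimplex m) := by
  refine isBounded_iff_forall_norm_le.2 ⟨Real.sqrt m, fun w hw => ?_⟩
  rw [EuclideanSpace.norm_eq]
  refine Real.sqrt_le_sqrt ?_
  calc ∑ j, ‖w j‖ ^ 2 ≤ ∑ _j : Fin m, (1 : ℝ) := Finset.sum_le_sum fun j _ => by
        have h0 := hw.1 j
        have h1 : w j ≤ 1 :=
          (Finset.single_le_sum (f := fun j => w j) (fun j _ => hw.1 j) (Finset.mem_univ j)).trans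
            hw.2
        rw [Real.norm_of_nonneg h0]
        nlinarith
    _ = m := by simp

theorem mem_interior_cornerSimplex {m : ℕ} {w : EuclideanSpace ℝ (Fin m)}
    (h0 : ∀ j, 0 < w j) (h1 : ∑ j, w j < 1) : w ∈ interior (cornerSimplex m) := by
  have hopen : IsOpen ({w : EuclideanSpace ℝ (Fin m) | ∀ j, 0 < w j} ∩ {w | ∑ j, w j < 1}) := by
    refine IsOpen.inter ?_ (isOpen_lt (by fun_prop) continuous_const)
    rw [ofPred_forall]
    exact isOpen_iInter_of_finite fun j => isOpen_lt continuous_const (by fun_prop)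
  have hsub : {w : EuclideanSpace ℝ (Fin m) | ∀ j, 0 < w j} ∩ {w | ∑ j, w j < 1} ⊆
      cornerSimplex m := fun w hw => ⟨fun j => (hw.1 j).le, hw.2.le⟩
  exact interior_maximal hsub hopen ⟨h0, h1⟩

theorem nonempty_interior_cornerSimplex (m : ℕ) : (interior (cornerSimplex m)).Nonempty := by
  refine ⟨WithLp.toLp 2 fun _ => 1 / (m + 1 : ℝ), mem_interior_cornerSimplex (fun j => ?_) ?_⟩
  · positivity
  · simp only [Finset.sum_const, Finset.card_univ, Fintype.card_fin, nsmul_eq_mul]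
    rw [mul_one_div, div_lt_one (by positivity)]
    exact lt_add_one _

theorem mem_frontier_cornerSimplex {m : ℕ} {w : EuclideanSpace ℝ (Fin m)} :
    w ∈ frontier (cornerSimplex m) ↔ w ∈ cornerSimplex m ∧ ((∃ j, w j = 0) ∨ ∑ j, w j = 1) := by
  rw [(isClosed_cornerSimplex m).frontier_eq]
  refine ⟨fun h => ⟨h.1, ?_⟩, fun h => ⟨h.1, fun hint => ?_⟩⟩
  · by_contra! hne
    exact h.2 (mem_interior_cornerSimplex (fun j => (h.1.1 j).lt_of_ne (hne.1 j).symm)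
      (h.1.2.lt_of_ne hne.2))
  · rcases h.2 with ⟨j, hj⟩ | hsum
    · have hcont : Continuous fun ε : ℝ => w - ε • EuclideanSpace.single j (1 : ℝ) := by fun_prop
      have hev : ∀ᶠ ε in nhds (0 : ℝ), w - ε • EuclideanSpace.single j (1 : ℝ) ∈ cornerSimplex m :=
        hcont.continuousAt.eventually (by simpa using mem_interior_iff_mem_nhds.1 hint)
      obtain ⟨ε, hmem, hpos⟩ :=
        ((hev.filter_mono nhdsWithin_le_nhds).and (self_mem_nhdsWithin (s := Ioi 0))).exists
      have := hmem.1 j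
      simp [hj] at this
      exact absurd hpos (not_lt.2 this)
    · have hcont : Continuous fun ε : ℝ => (1 + ε) • w := by fun_prop
      have hev : ∀ᶠ ε in nhds (0 : ℝ), (1 + ε) • w ∈ cornerSimplex m :=
        hcont.continuousAt.eventually (by simpa using mem_interior_iff_mem_nhds.1 hint)
      obtain ⟨ε, hmem, hpos⟩ :=
        ((hev.filter_mono nhdsWithin_le_nhds).and (self_mem_nhdsWithin (s := Ioi 0))).exists
      have := hmem.2
      simp only [PiLp.smul_apply, smul_eq_mul, ← Finset.mul_sum, hsum] at this
      have hp : 0 < ε := hpos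
      linarith

/-- A simplex with `m + 1` vertices is homeomorphic to the unit ball of `ℝ^m`, its boundary
corresponding to the sphere. The homeomorphism is given as a pair of maps defined everywhere. -/
theorem exists_simplexOn_ball {ι : Type*} {m : ℕ} {τ : Finset ι} (hτ : τ.card = m + 1) :
    ∃ (a : (ι → ℝ) → EuclideanSpace ℝ (Fin m)) (b : EuclideanSpace ℝ (Fin m) → ι → ℝ),
      Continuous a ∧ Continuous b ∧ MapsTo a (simplexOn τ) (closedBall 0 1) ∧
      MapsTo b (closedBall 0 1) (simplexOn τ) ∧ (∀ t ∈ simplexOn τ, b (a t) = t) ∧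
      (∀ t ∈ simplexOn τ, (∃ i ∈ τ, t i = 0) → a t ∈ sphere 0 1) ∧
      ∀ w ∈ sphere (0 : EuclideanSpace ℝ (Fin m)) 1, ∃ i ∈ τ, b w i = 0 := by
  classical
  obtain ⟨h, -, hcl, hfr⟩ := exists_homeomorph_image_interior_closure_frontier_eq_unitBall
    (convex_cornerSimplex m) (nonempty_interior_cornerSimplex m) (isBounded_cornerSimplex m)
  rw [(isClosed_cornerSimplex m).closure_eq] at hcl
  let e : τ ≃ Fin (m + 1) := Finset.equivFinOfCardEq hτ
  let R : (ι → ℝ) → EuclideanSpace ℝ (Fin m) := fun t => WithLp.toLp 2 fun j => t (e.symm j.succ)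
  let c : EuclideanSpace ℝ (Fin m) → Fin (m + 1) → ℝ := fun w =>
    Fin.cons (1 - ∑ j, w j) fun j => w j
  let P : EuclideanSpace ℝ (Fin m) → ι → ℝ := fun w i => if hi : i ∈ τ then c w (e ⟨i, hi⟩) else 0
  have hPe : ∀ w j, P w (e.symm j) = c w j := by
    intro w j
    simp [P]
  have hsum : ∀ f : ι → ℝ, ∑ i ∈ τ, f i = f (e.symm 0) + ∑ j : Fin m, f (e.symm j.succ) := by
    intro f
    rw [← Fin.sum_univ_succ (f := fun j => f (e.symm j)), ← Finset.sum_coe_sort τ]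
    exact Fintype.sum_equiv e _ _ fun i => by simp
  have hR : Continuous R := by fun_prop
  have hP : Continuous P := by
    refine continuous_pi fun i => ?_
    by_cases hi : i ∈ τ
    · simp only [P, hi, dif_pos]
      generalize e ⟨i, hi⟩ = j
      refine Fin.cases ?_ (fun j => ?_) j
      · simp only [c, Fin.cons_zero]; fun_prop
      · simp only [c, Fin.cons_succ]; fun_prop
    · simp only [P, hi, dif_neg, not_false_iff]; exact continuous_const
  have hRs : ∀ t ∈ simplexOn τ, R t ∈ cornerSimplex m := by
    intro t ht
    have h1 := hsum t
    rw [ht.2.2] at h1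
    exact ⟨fun j => ht.1 _, by simp only [R]; linarith [ht.1 (e.symm 0)]⟩
  have hPs : ∀ w ∈ cornerSimplex m, P w ∈ simplexOn τ := by
    intro w hw
    refine ⟨fun i => ?_, fun i hi => dif_neg hi, ?_⟩
    · by_cases hi : i ∈ τ
      · simp only [P, hi, dif_pos]
        generalize e ⟨i, hi⟩ = j
        refine Fin.cases ?_ (fun j => ?_) j
        · simp only [c, Fin.cons_zero]; linarith [hw.2]
        · exact hw.1 j
      · simp only [P, hi, dif_neg, not_false_iff, le_refl]
    · rw [hsum, hPe]
      simp only [hPe]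
      simp [c]
  have hPR : ∀ t ∈ simplexOn τ, P (R t) = t := by
    intro t ht
    have h1 := hsum t
    rw [ht.2.2] at h1
    funext i
    by_cases hi : i ∈ τ
    · obtain ⟨j, hj⟩ := e.symm.surjective ⟨i, hi⟩
      have hij : i = e.symm j := by rw [hj]
      rw [hij, hPe]
      refine Fin.cases ?_ (fun j => ?_) j
      · simp only [c, Fin.cons_zero, R]; linarith
      · simp only [c, Fin.cons_succ, R]
    · simp only [P, hi, dif_neg, not_false_iff, ht.2.1 i hi]
  have hsymm : ∀ {s t : Set (EuclideanSpace ℝ (Fin m))}, h '' s = t → ∀ w ∈ t, h.symm w ∈ s := by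
    rintro s _ rfl _ ⟨w, hw, rfl⟩
    simpa using hw
  refine ⟨fun t => h (R t), fun w => P (h.symm w), h.continuous.comp hR,
    hP.comp h.symm.continuous, fun t ht => hcl ▸ mem_image_of_mem h (hRs t ht),
    fun w hw => hPs _ (hsymm hcl w hw), fun t ht => by simp [hPR t ht], ?_, ?_⟩
  · rintro t ht ⟨i, hi, hti⟩
    refine hfr ▸ mem_image_of_mem h (mem_frontier_cornerSimplex.2 ⟨hRs t ht, ?_⟩)
    obtain ⟨j, hj⟩ := e.symm.surjective ⟨i, hi⟩
    have hij : t (e.symm j) = 0 := by rw [hj]; exact hti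
    have h1 := hsum t
    rw [ht.2.2] at h1
    revert hij
    refine Fin.cases (fun hij => Or.inr ?_) (fun j hij => Or.inl ⟨j, hij⟩) j
    simp only [R]; linarith
  · intro w hw
    obtain ⟨-, ⟨j, hj⟩ | h1⟩ := mem_frontier_cornerSimplex.1 (hsymm hfr w hw)
    · exact ⟨e.symm j.succ, (e.symm j.succ).2, (hPe _ _).trans (by simpa [c] using hj)⟩
    · exact ⟨e.symm 0, (e.symm 0).2, (hPe _ _).trans (by simp [c, h1])⟩

/-- Every continuous map of the unit sphere of `ℝ^m` into `B` extends to a continuous map of the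
closed unit ball into `C`. -/
def SphereExtends (m : ℕ) {Y : Type*} [TopologicalSpace Y] (B C : Set Y) : Prop :=
  ∀ f : C(sphere (0 : EuclideanSpace ℝ (Fin m)) 1, Y), (∀ s, f s ∈ B) →
    ∃ h : C(closedBall (0 : EuclideanSpace ℝ (Fin m)) 1, Y),
      (∀ s : sphere (0 : EuclideanSpace ℝ (Fin m)) 1,
        h ⟨s, sphere_subset_closedBall s.2⟩ = f s) ∧ ∀ b, h b ∈ C

theorem SphereExtends.exists_extend_simplexOn {m : ℕ} {Y ι : Type*} [TopologicalSpace Y]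
    [DecidableEq ι] {B C : Set Y} (hBC : SphereExtends m B C) {τ : Finset ι} (hτ : τ.card = m + 1)
    (u : (ι → ℝ) → Y) (hu : ∀ i ∈ τ, ContinuousOn u (simplexOn (τ.erase i)))
    (huB : ∀ i ∈ τ, MapsTo u (simplexOn (τ.erase i)) B) :
    ∃ v : (ι → ℝ) → Y, ContinuousOn v (simplexOn τ) ∧ MapsTo v (simplexOn τ) C ∧
      ∀ t ∈ simplexOn τ, (∃ i ∈ τ, t i = 0) → v t = u t := by
  obtain ⟨a, b, ha, hb, haΔ, hbΔ, hba, has, hbs⟩ := exists_simplexOn_ball hτ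
  have hucont : ContinuousOn u (⋃ i : τ, simplexOn (τ.erase i)) :=
    (locallyFinite_of_finite _).continuousOn_iUnion (fun i => isClosed_simplexOn _)
      fun i => hu i i.2
  have hbd : ∀ w ∈ sphere (0 : EuclideanSpace ℝ (Fin m)) 1,
      ∃ i ∈ τ, b w ∈ simplexOn (τ.erase i) := by
    intro w hw
    obtain ⟨i, hi, h0⟩ := hbs w hw
    exact ⟨i, hi, simplexOn_erase (hbΔ (sphere_subset_closedBall hw)) h0⟩
  have hfc : ContinuousOn (fun w => u (b w)) (sphere 0 1) :=
    hucont.comp hb.continuousOn fun w hw => by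
      obtain ⟨i, hi, h⟩ := hbd w hw
      exact mem_iUnion.2 ⟨⟨i, hi⟩, h⟩
  obtain ⟨h, hext, hC⟩ := hBC ⟨(sphere 0 1).domRestrict fun w => u (b w),
    continuousOn_iff_continuous_domRestrict.1 hfc⟩ (by
      rintro ⟨w, hw⟩
      obtain ⟨i, hi, h⟩ := hbd w hw
      exact huB i hi h)
  classical
  let v : (ι → ℝ) → Y := fun t => if ht : a t ∈ closedBall 0 1 then h ⟨a t, ht⟩ else u t
  have hv : ∀ t (ht : t ∈ simplexOn τ), v t = h ⟨a t, haΔ ht⟩ := fun t ht => dif_pos (haΔ ht)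
  refine ⟨v, ?_, fun t ht => by rw [hv t ht]; exact hC _, fun t ht hbdy => ?_⟩
  · rw [continuousOn_iff_continuous_domRestrict]
    have : (simplexOn τ).domRestrict v = fun t : simplexOn τ => h ⟨a t, haΔ t.2⟩ :=
      funext fun t => hv t t.2
    rw [this]
    exact h.continuous.comp ((ha.comp continuous_subtype_val).subtype_mk _)
  · rw [hv t ht]
    refine (hext ⟨a t, has t ht hbdy⟩).trans ?_
    exact congrArg u (hba t ht)

/-! ### Selections over the skeletons of nerves of covers -/

/-- The simplicial map of barycentric coordinates induced by a map `p` of vertices. -/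
noncomputable def pushWeights {κ ι : Type*} [DecidableEq ι] (p : κ → ι) (t : κ → ℝ) : ι → ℝ :=
  fun i => ∑ᶠ a, if p a = i then t a else 0

theorem pushWeights_apply {κ ι : Type*} [DecidableEq ι] (p : κ → ι) {T : Finset κ} {t : κ → ℝ}
    (ht : t ∈ simplexOn T) (i : ι) :
    pushWeights p t i = ∑ a ∈ T, if p a = i then t a else 0 := by
  refine finsum_eq_sum_of_support_subset _ fun a ha => ?_
  by_contra haT
  exact ha (by simp [ht.2.1 a haT])

theorem continuousOn_pushWeights {κ ι : Type*} [DecidableEq ι] (p : κ → ι) (T : Finset κ) :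
    ContinuousOn (pushWeights p) (simplexOn T) := by
  have : ContinuousOn (fun (t : κ → ℝ) i => ∑ a ∈ T, if p a = i then t a else 0)
      (simplexOn T) := by
    refine (continuous_pi fun i => continuous_finsetSum _ fun a _ => ?_).continuousOn
    split_ifs
    · exact continuous_apply a
    · exact continuous_const
  exact this.congr fun t ht => funext fun i => pushWeights_apply p ht i

theorem mapsTo_pushWeights {κ ι : Type*} [DecidableEq ι] (p : κ → ι) (T : Finset κ) :
    MapsTo (pushWeights p) (simplexOn T) (simplexOn (T.image p)) := by
  intro t ht
  refine ⟨fun i => ?_, fun i hi => ?_, ?_⟩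
  · rw [pushWeights_apply p ht]
    refine Finset.sum_nonneg fun a _ => ?_
    split_ifs
    exacts [ht.1 a, le_rfl]
  · rw [pushWeights_apply p ht]
    refine Finset.sum_eq_zero fun a ha => if_neg ?_
    rintro rfl
    exact hi (Finset.mem_image_of_mem p ha)
  · simp only [pushWeights_apply p ht]
    rw [Finset.sum_comm, ← ht.2.2]
    refine Finset.sum_congr rfl fun a ha => ?_
    rw [Finset.sum_ite_eq, if_pos (Finset.mem_image_of_mem p ha)]

/-- `V` is a locally finite open cover, and `u` maps the `k`-skeleton of its nerve to `Y`
continuously on simplices, each simplex into `Ψ x` for all `x` in the intersection of its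
vertices. -/
structure IsSkeletalSelection {X Y ι : Type*} [TopologicalSpace X] [TopologicalSpace Y]
    (Ψ : X → Set Y) (k : ℕ) (V : ι → Set X) (u : (ι → ℝ) → Y) : Prop where
  isOpen : ∀ i, IsOpen (V i)
  iUnion_eq : ⋃ i, V i = univ
  locallyFinite : LocallyFinite V
  continuousOn : ∀ x, ∀ σ : Finset ι, σ.card ≤ k + 1 → (∀ i ∈ σ, x ∈ V i) →
    ContinuousOn u (simplexOn σ)
  mapsTo : ∀ x, ∀ σ : Finset ι, σ.card ≤ k + 1 → (∀ i ∈ σ, x ∈ V i) →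
    MapsTo u (simplexOn σ) (Ψ x)

theorem exists_isSkeletalSelection_zero {X Y : Type*} [TopologicalSpace X] [ParacompactSpace X]
    [Nonempty X] [TopologicalSpace Y] {Ψ : X → Set Y} (hΨ : IsOpen {p : X × Y | p.2 ∈ Ψ p.1})
    (hne : ∀ x, (Ψ x).Nonempty) :
    ∃ (V : X → Set X) (u : (X → ℝ) → Y), IsSkeletalSelection Ψ 0 V u := by
  choose y hy using hne
  obtain ⟨V, hVo, hVc, hVlf, hV⟩ := precise_refinement (fun x => {x' | y x ∈ Ψ x'})
    (fun x => hΨ.preimage (f := fun x' => (x', y x)) (by fun_prop))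
    (eq_univ_of_forall fun x => mem_iUnion.2 ⟨x, hy x⟩)
  -- `u` sends the vertex with index `i` to `y i`
  let u : (X → ℝ) → Y := fun t => y (Classical.epsilon fun i => t i ≠ 0)
  have hu : ∀ i, ∀ t ∈ simplexOn ({i} : Finset X), u t = y i := by
    intro i t ht
    have hti : t i ≠ 0 := by
      have := ht.2.2
      rw [Finset.sum_singleton] at this
      rw [this]; exact one_ne_zero
    have hε : t (Classical.epsilon fun i => t i ≠ 0) ≠ 0 :=
      Classical.epsilon_spec (p := fun i => t i ≠ 0) ⟨i, hti⟩
    refine congrArg y ?_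
    by_contra hne
    exact hε (ht.2.1 _ fun h => hne (Finset.mem_singleton.1 h))
  have hσ : ∀ σ : Finset X, σ.card ≤ 0 + 1 → simplexOn σ = ∅ ∨ ∃ i, σ = {i} := by
    intro σ hc
    rcases Finset.card_le_one_iff_subset_singleton.1 hc with ⟨i, hi⟩
    rcases Finset.subset_singleton_iff.1 hi with rfl | rfl
    · refine Or.inl (eq_empty_of_forall_notMem fun t ht => ?_)
      simpa using ht.2.2
    · exact Or.inr ⟨i, rfl⟩
  refine ⟨V, u, hVo, hVc, hVlf, fun x σ hc hx => ?_, fun x σ hc hx => ?_⟩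
  · rcases hσ σ hc with h | ⟨i, rfl⟩
    · rw [h]; exact continuousOn_empty _
    · exact continuousOn_const.congr (hu i)
  · rcases hσ σ hc with h | ⟨i, rfl⟩
    · rw [h]; exact mapsTo_empty _ _
    · intro t ht
      rw [hu i t ht]
      exact hV i (hx i (Finset.mem_singleton_self i))

/-- The inductive step. Over each `x` the map extends to the `(k+1)`-simplices of the nerve whose
vertices contain `x`; by compactness the extension is good for all points of a neighbourhood `O x`
of `x`. A new cover refining both `V` and `O` lets one choose, for each of its simplices, the
extension over one of its vertices. -/
theorem IsSkeletalSelection.exists_succ {X Y ι : Type*} [TopologicalSpace X] [T2Space X]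
    [ParacompactSpace X] [TopologicalSpace Y] {Ψ Ψ' : X → Set Y} {k : ℕ} {V : ι → Set X}
    {u : (ι → ℝ) → Y} (h : IsSkeletalSelection Ψ k V u)
    (hΨ' : IsOpen {p : X × Y | p.2 ∈ Ψ' p.1}) (hmono : ∀ x, Ψ x ⊆ Ψ' x)
    (hext : ∀ x, SphereExtends (k + 1) (Ψ x) (Ψ' x)) :
    ∃ (W : X → Set X) (u' : (X → ℝ) → Y), IsSkeletalSelection Ψ' (k + 1) W u' := by
  classical
  have hext' : ∀ x (τ : Finset ι), ∃ v : (ι → ℝ) → Y, τ.card = k + 2 → (∀ i ∈ τ, x ∈ V i) →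
      ContinuousOn v (simplexOn τ) ∧ MapsTo v (simplexOn τ) (Ψ' x) ∧
        ∀ t ∈ simplexOn τ, (∃ i ∈ τ, t i = 0) → v t = u t := by
    intro x τ
    by_cases hτ : τ.card = k + 2 ∧ ∀ i ∈ τ, x ∈ V i
    · have hcard : ∀ i ∈ τ, (τ.erase i).card ≤ k + 1 := fun i hi => by
        rw [Finset.card_erase_of_mem hi, hτ.1]; omega
      have hmem : ∀ i, ∀ j ∈ τ.erase i, x ∈ V j := fun i j hj => hτ.2 j (Finset.mem_of_mem_erase hj)
      obtain ⟨v, hv⟩ := (hext x).exists_extend_simplexOn hτ.1 u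
        (fun i hi => h.continuousOn x _ (hcard i hi) (hmem i))
        (fun i hi => h.mapsTo x _ (hcard i hi) (hmem i))
      exact ⟨v, fun _ _ => hv⟩
    · exact ⟨u, fun h1 h2 => absurd ⟨h1, h2⟩ hτ⟩
  choose v hv using hext'
  obtain ⟨V', hV'c, hV'o, hV'V⟩ := exists_iUnion_eq_closure_subset h.isOpen
    (fun x => h.locallyFinite.point_finite x) h.iUnion_eq
  have hV'lf : LocallyFinite V' := h.locallyFinite.subset fun i => subset_closure.trans (hV'V i)
  choose i hi using fun x => mem_iUnion.1 (hV'c ▸ mem_univ x : x ∈ ⋃ i, V' i)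
  let σ : X → Finset ι := fun x => (h.locallyFinite.point_finite x).toFinset
  have hσ : ∀ {x j}, j ∈ σ x ↔ x ∈ V j := fun {x j} => Finite.mem_toFinset _
  have hO : ∀ x, ∃ O : Set X, IsOpen O ∧ x ∈ O ∧ (∀ x' ∈ O, ∀ j, x' ∈ V' j → x ∈ V j) ∧
      ∀ x' ∈ O, ∀ τ : Finset ι, τ.card = k + 2 → (∀ j ∈ τ, x ∈ V j) →
        MapsTo (v x τ) (simplexOn τ) (Ψ' x') := by
    intro x
    have h1 : ∀ᶠ x' in nhds x, x' ∈ (⋃ j : {j // x ∉ closure (V' j)}, closure (V' j))ᶜ := by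
      refine IsOpen.mem_nhds ?_ ?_
      · exact ((hV'lf.closure.comp_injective Subtype.val_injective).isClosed_iUnion
          fun j => isClosed_closure).isOpen_compl
      · intro hx
        obtain ⟨j, hj⟩ := mem_iUnion.1 hx
        exact j.2 hj
    have h2 : ∀ᶠ x' in nhds x, ∀ τ ∈ (σ x).powerset, τ.card = k + 2 →
        ∀ y ∈ v x τ '' simplexOn τ, (x', y) ∈ {p : X × Y | p.2 ∈ Ψ' p.1} := by
      refine (Filter.eventually_all_finset _).2 fun τ hτ => ?_
      by_cases hc : τ.card = k + 2
      · have hx : ∀ j ∈ τ, x ∈ V j := fun j hj => hσ.1 (Finset.mem_powerset.1 hτ hj)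
        have hK := (isCompact_simplexOn τ).image_of_continuousOn (hv x τ hc hx).1
        filter_upwards [hK.eventually_forall_of_forall_eventually (x₀ := x)
          (P := fun x' y => (x', y) ∈ {p : X × Y | p.2 ∈ Ψ' p.1}) (by
            rintro _ ⟨t, ht, rfl⟩
            exact hΨ'.mem_nhds ((hv x τ hc hx).2.1 ht))] with x' hx' _ using hx'
      · exact Filter.Eventually.of_forall fun x' h' => absurd h' hc
    obtain ⟨O, hOsub, hOo, hxO⟩ := mem_nhds_iff.1 (h1.and h2)
    refine ⟨O, hOo, hxO, fun x' hx' j hj => ?_, fun x' hx' τ hc hx t ht => ?_⟩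
    · by_contra hxj
      exact (hOsub hx').1 (mem_iUnion.2 ⟨⟨j, fun hcl => hxj (hV'V j hcl)⟩, subset_closure hj⟩)
    · exact (hOsub hx').2 τ (Finset.mem_powerset.2 fun j hj => hσ.2 (hx j hj)) hc _
        (mem_image_of_mem _ ht)
  choose O hOo hxO hOV hOΨ using hO
  obtain ⟨W, hWo, hWc, hWlf, hWsub⟩ := precise_refinement (fun x => O x ∩ V' (i x))
    (fun x => (hOo x).inter (hV'o _)) (eq_univ_of_forall fun x => mem_iUnion.2 ⟨x, hxO x, hi x⟩)
  -- `c S` is the vertex of `S` over which the extension is chosen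
  have hc : ∀ S : Finset X, ∃ a : Option X, ∀ hS : S.Nonempty, ∃ b ∈ S, a = some b := by
    intro S
    by_cases hS : S.Nonempty
    · exact ⟨some hS.choose, fun hS => ⟨_, hS.choose_spec, rfl⟩⟩
    · exact ⟨none, fun h => absurd h hS⟩
  choose c hcS using hc
  -- the vertices of the smallest simplex containing `t`
  let supp : (X → ℝ) → Finset X := fun t =>
    if hf : (Function.support t).Finite then hf.toFinset else ∅
  have hsupp : ∀ {T : Finset X} {t : X → ℝ}, t ∈ simplexOn T → ∀ a, a ∈ supp t ↔ t a ≠ 0 := by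
    intro T t ht a
    have hf : (Function.support t).Finite := T.finite_toSet.subset fun a ha => by
      by_contra haT
      exact ha (ht.2.1 a haT)
    simp only [supp, dif_pos hf, Finite.mem_toFinset, Function.mem_support]
  let u' : (X → ℝ) → Y := fun t =>
    if (supp t).card = k + 2 ∧ ((supp t).image i).card = k + 2 then
      (c (supp t)).elim (u (pushWeights i t))
        fun a => v a ((supp t).image i) (pushWeights i t)
    else u (pushWeights i t)
  have key : ∀ x, ∀ T : Finset X, T.card ≤ k + 1 + 1 → (∀ a ∈ T, x ∈ W a) →
      ContinuousOn u' (simplexOn T) ∧ MapsTo u' (simplexOn T) (Ψ' x) := by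
    intro x T hT hx
    have hsub : ∀ t ∈ simplexOn T, supp t ⊆ T := by
      intro t ht a ha
      by_contra haT
      exact (hsupp ht a).1 ha (ht.2.1 a haT)
    have hsuppΔ : ∀ t ∈ simplexOn T, t ∈ simplexOn (supp t) := by
      intro t ht
      refine ⟨ht.1, fun a ha => ?_, ?_⟩
      · by_contra hne
        exact ha ((hsupp ht a).2 hne)
      · rw [← ht.2.2]
        refine Finset.sum_subset (hsub t ht) fun a _ ha => ?_
        by_contra hne
        exact ha ((hsupp ht a).2 hne)
    by_cases hA : T.card = k + 2 ∧ (T.image i).card = k + 2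
    · obtain ⟨a, haT, hca⟩ := hcS T (Finset.card_pos.1 (by omega))
      have haV : ∀ j ∈ T.image i, a ∈ V j := by
        intro j hj
        obtain ⟨b, hb, rfl⟩ := Finset.mem_image.1 hj
        exact hOV a x (hWsub a (hx a haT)).1 _ (hWsub b (hx b hb)).2
      obtain ⟨hv1, -, hv3⟩ := hv a (T.image i) hA.2 haV
      have heq : ∀ t ∈ simplexOn T, u' t = v a (T.image i) (pushWeights i t) := by
        intro t ht
        by_cases hS : supp t = T
        · simp only [u', hS, hA.1, hA.2, and_self, if_true, hca, Option.elim]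
        · have hlt : (supp t).card < T.card :=
            Finset.card_lt_card ((hsub t ht).ssubset_of_ne hS)
          have hif : ¬ ((supp t).card = k + 2 ∧ ((supp t).image i).card = k + 2) := by omega
          simp only [u', if_neg hif]
          refine (hv3 _ (mapsTo_pushWeights i T ht) ?_).symm
          have : ¬ T.image i ⊆ (supp t).image i := fun hss => by
            have h1 := Finset.card_le_card hss
            have h2 := Finset.card_image_le (s := supp t) (f := i)
            omega
          obtain ⟨j, hj, hj'⟩ := Finset.not_subset.1 this
          exact ⟨j, hj, (mapsTo_pushWeights i _ (hsuppΔ t ht)).2.1 j hj'⟩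
      refine ⟨?_, fun t ht => ?_⟩
      · exact (hv1.comp (continuousOn_pushWeights i T) (mapsTo_pushWeights i T)).congr heq
      · rw [heq t ht]
        exact hOΨ a x (hWsub a (hx a haT)).1 _ hA.2 haV (mapsTo_pushWeights i T ht)
    · have heq : ∀ t ∈ simplexOn T, u' t = u (pushWeights i t) := by
        intro t ht
        refine if_neg fun hS => hA ?_
        have : supp t = T := Finset.eq_of_subset_of_card_le (hsub t ht) (by omega)
        rwa [this] at hS
      have hcard : (T.image i).card ≤ k + 1 := by
        have := Finset.card_image_le (s := T) (f := i)
        omega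
      have hxV : ∀ j ∈ T.image i, x ∈ V j := by
        intro j hj
        obtain ⟨b, hb, rfl⟩ := Finset.mem_image.1 hj
        exact hV'V _ (subset_closure (hWsub b (hx b hb)).2)
      refine ⟨?_, fun t ht => ?_⟩
      · exact ((h.continuousOn x _ hcard hxV).comp (continuousOn_pushWeights i T)
          (mapsTo_pushWeights i T)).congr heq
      · rw [heq t ht]
        exact hmono x (h.mapsTo x _ hcard hxV (mapsTo_pushWeights i T ht))
  exact ⟨W, u', hWo, hWc, hWlf, fun x T h1 h2 => (key x T h1 h2).1,
    fun x T h1 h2 => (key x T h1 h2).2⟩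

/-- If `X` has dimension at most `k`, a selection over the `k`-skeleton of the nerve of a cover
gives a selection over `X`, by means of a partition of unity subordinate to a shrinking of the
cover of order at most `k`. -/
theorem IsSkeletalSelection.exists_selection.{u, v} {X ι : Type u} {Y : Type v}
    [TopologicalSpace X] [T2Space X] [ParacompactSpace X] [TopologicalSpace Y] {Ψ : X → Set Y}
    {k : ℕ} {V : ι → Set X} {u : (ι → ℝ) → Y} (h : IsSkeletalSelection Ψ k V u)
    (hX : HasShrinkingsOfOrderLE X k) :
    ∃ f : X → Y, Continuous f ∧ ∀ x, f x ∈ Ψ x := by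
  classical
  obtain ⟨W, hWo, hWc, hWV, hWlf, hWord⟩ := hX ι V h.isOpen h.iUnion_eq
  obtain ⟨φ, hφ⟩ := PartitionOfUnity.exists_isSubordinate_of_locallyFinite isClosed_univ W hWo hWlf
    hWc.ge
  have hφW : ∀ s x, φ s x ≠ 0 → x ∈ W s := fun s x hx =>
    hφ s (subset_tsupport _ (Function.mem_support.2 hx))
  let θ : X → ι → ℝ := fun x s => φ s x
  have hθ : Continuous θ := continuous_pi fun s => (φ s).continuous
  have hfin : ∀ x, {s | φ s x ≠ 0}.Finite := fun x =>
    (hWlf.point_finite x).subset fun s hs => hφW s x hs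
  have hθΔ : ∀ x, ∀ σ : Finset ι, (∀ s ∉ σ, φ s x = 0) → θ x ∈ simplexOn σ := by
    intro x σ hσ
    refine ⟨fun s => φ.nonneg s x, hσ, ?_⟩
    rw [← φ.sum_eq_one (mem_univ x)]
    refine (finsum_eq_sum_of_support_subset _ fun s hs => ?_).symm
    by_contra h'
    exact hs (hσ s h')
  have hcard : ∀ x, (hfin x).toFinset.card ≤ k + 1 := fun x =>
    hWord x _ fun s hs => hφW s x ((hfin x).mem_toFinset.1 hs)
  have hmem : ∀ x, ∀ s ∈ (hfin x).toFinset, x ∈ V s := fun x s hs =>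
    hWV s (hφW s x ((hfin x).mem_toFinset.1 hs))
  have hself : ∀ x, θ x ∈ simplexOn (hfin x).toFinset := fun x => hθΔ x _ fun s hs => by
    by_contra hne
    exact hs ((hfin x).mem_toFinset.2 hne)
  refine ⟨fun x => u (θ x), continuous_iff_continuousAt.2 fun x => ?_, fun x =>
    h.mapsTo x _ (hcard x) (hmem x) (hself x)⟩
  -- near `x` only finitely many simplices occur
  obtain ⟨U, hU, hUfin⟩ := φ.locallyFinite x
  let A : Set (Finset ι) := {σ | ∃ y ∈ U, σ = (hfin y).toFinset}
  have hAfin : A.Finite := by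
    refine (Finset.finite_toSet hUfin.toFinset.powerset).subset ?_
    rintro _ ⟨y, hy, rfl⟩
    refine Finset.mem_coe.2 (Finset.mem_powerset.2 fun s hs => hUfin.mem_toFinset.2 ?_)
    exact ⟨y, Function.mem_support.2 ((hfin y).mem_toFinset.1 hs), hy⟩
  have : Finite A := hAfin
  have hcont : ContinuousOn (fun x => u (θ x)) (⋃ σ : A, θ ⁻¹' simplexOn σ.1) := by
    refine (locallyFinite_of_finite _).continuousOn_iUnion
      (fun σ => (isClosed_simplexOn _).preimage hθ) ?_
    rintro ⟨_, y, -, rfl⟩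
    exact (h.continuousOn y _ (hcard y) (hmem y)).comp hθ.continuousOn fun z hz => hz
  refine hcont.continuousAt (Filter.mem_of_superset hU fun y hy => ?_)
  exact mem_iUnion.2 ⟨⟨_, y, hy, rfl⟩, hself y⟩

/-- The selection theorem for an increasing sequence of set-valued maps with open graphs in which
spheres of dimension `k` in the `k`-th map bound balls in the next one, on a paracompact space of
dimension at most `N`. -/
theorem exists_continuous_selection.{u, v} {X : Type u} {Y : Type v} [TopologicalSpace X]
    [T2Space X] [ParacompactSpace X] [TopologicalSpace Y] {N : ℕ}
    (hX : HasShrinkingsOfOrderLE X N) (Ψ : ℕ → X → Set Y)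
    (hopen : ∀ k, IsOpen {p : X × Y | p.2 ∈ Ψ k p.1}) (hne : ∀ x, (Ψ 0 x).Nonempty)
    (hmono : ∀ k < N, ∀ x, Ψ k x ⊆ Ψ (k + 1) x)
    (hext : ∀ k < N, ∀ x, SphereExtends (k + 1) (Ψ k x) (Ψ (k + 1) x)) :
    ∃ f : X → Y, Continuous f ∧ ∀ x, f x ∈ Ψ N x := by
  rcases isEmpty_or_nonempty X with hX' | hX'
  · exact ⟨fun x => isEmptyElim x, continuous_of_const fun x => isEmptyElim x,
      fun x => isEmptyElim x⟩
  have hskel : ∀ k ≤ N, ∃ (V : X → Set X) (u : (X → ℝ) → Y), IsSkeletalSelection (Ψ k) k V u := by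
    intro k
    induction k with
    | zero => exact fun _ => exists_isSkeletalSelection_zero (hopen 0) hne
    | succ k ih =>
      intro hk
      obtain ⟨V, u, h⟩ := ih (by omega)
      exact h.exists_succ (hopen (k + 1)) (hmono k hk) (hext k hk)
  obtain ⟨V, u, h⟩ := hskel N le_rfl
  exact h.exists_selection hX

/-! ### The covering dimension of spheres -/

theorem HasShrinkingsOfOrderLE.of_homeomorph.{u} {X Y : Type u} [TopologicalSpace X]
    [TopologicalSpace Y] {N : ℕ} (h : HasShrinkingsOfOrderLE X N) (e : Y ≃ₜ X) :
    HasShrinkingsOfOrderLE Y N := by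
  intro ι V hV hc
  obtain ⟨W, hWo, hWc, hWV, hWlf, hWord⟩ := h ι (fun i => e.symm ⁻¹' V i)
    (fun i => (hV i).preimage e.symm.continuous) (by rw [← preimage_iUnion, hc, preimage_univ])
  refine ⟨fun i => e ⁻¹' W i, fun i => (hWo i).preimage e.continuous,
    by rw [← preimage_iUnion, hWc, preimage_univ], fun i y hy => by simpa using hWV i hy,
    hWlf.preimage_continuous e.continuous, fun y σ hσ => hWord (e y) σ hσ⟩

/-- Thresholds `0 < r 0 < r 1 < ⋯ < r d < 1 / 2` for the distance of a coordinate to `ℤ`. -/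
noncomputable def gridRadius (d c : ℕ) : ℝ := (c + 1) / (3 * (d + 1))

theorem gridRadius_pos (d c : ℕ) : 0 < gridRadius d c := by
  unfold gridRadius; positivity

theorem gridRadius_lt_succ (d c : ℕ) : gridRadius d c < gridRadius d (c + 1) := by
  unfold gridRadius
  push_cast
  gcongr
  linarith

theorem gridRadius_lt_half {d c : ℕ} (h : c ≤ d) : gridRadius d c < 1 / 2 := by
  unfold gridRadius
  have : (c : ℝ) ≤ d := by exact_mod_cast h
  rw [div_lt_div_iff₀ (by positivity) (by norm_num)]
  nlinarith

/-- A neighbourhood of the open face of the integer grid of `ℝ^d` in which the coordinates in `T`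
are the given integers `p j`, and the other coordinates lie between `p j` and `p j + 1`. Its size
depends on the number of elements of `T` in such a way that cells with equally many fixed
coordinates are disjoint. -/
def gridCell {d : ℕ} (T : Finset (Fin d)) (p : Fin d → ℤ) : Set (Fin d → ℝ) :=
  {z | (∀ j ∈ T, |z j - p j| < gridRadius d T.card) ∧
    ∀ j ∉ T, gridRadius d T.card < z j - p j ∧ z j - p j < 1 - gridRadius d T.card}

theorem isOpen_gridCell {d : ℕ} (T : Finset (Fin d)) (p : Fin d → ℤ) : IsOpen (gridCell T p) := by
  have h1 : IsOpen {z : Fin d → ℝ | ∀ j ∈ T, |z j - p j| < gridRadius d T.card} := by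
    simp only [ofPred_forall]
    exact isOpen_iInter_of_finite fun j => isOpen_iInter_of_finite fun _ =>
      isOpen_lt (by fun_prop) continuous_const
  have h2 : IsOpen {z : Fin d → ℝ | ∀ j ∉ T, gridRadius d T.card < z j - p j ∧
      z j - p j < 1 - gridRadius d T.card} := by
    simp only [ofPred_forall]
    refine isOpen_iInter_of_finite fun j => isOpen_iInter_of_finite fun _ => ?_
    exact (isOpen_lt (f := fun _ : Fin d → ℝ => gridRadius d T.card) continuous_const
      (g := fun z => z j - p j) (by fun_prop)).inter
      (isOpen_lt (f := fun z : Fin d → ℝ => z j - p j) (by fun_prop) continuous_const)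
  exact h1.inter h2

theorem abs_sub_lt_one_of_mem_gridCell {d : ℕ} {T : Finset (Fin d)} {p : Fin d → ℤ}
    {z w : Fin d → ℝ} (hz : z ∈ gridCell T p) (hw : w ∈ gridCell T p) (j : Fin d) :
    |z j - w j| < 1 := by
  have hr := gridRadius_lt_half (d := d) (c := T.card) (by simpa using T.card_le_univ)
  have hr0 := gridRadius_pos d T.card
  by_cases hj : j ∈ T
  · have h1 := abs_lt.1 (hz.1 j hj)
    have h2 := abs_lt.1 (hw.1 j hj)
    exact abs_lt.2 ⟨by linarith, by linarith⟩
  · have h1 := hz.2 j hj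
    have h2 := hw.2 j hj
    exact abs_lt.2 ⟨by linarith, by linarith⟩

theorem gridCell_eq_of_mem {d : ℕ} {T T' : Finset (Fin d)} {p p' : Fin d → ℤ} {z : Fin d → ℝ}
    (hz : z ∈ gridCell T p) (hz' : z ∈ gridCell T' p') (hcard : T.card = T'.card) :
    T = T' ∧ p = p' := by
  have hr := gridRadius_lt_half (d := d) (c := T.card) (by simpa using T.card_le_univ)
  have hr0 := gridRadius_pos d T.card
  have hT : T = T' := by
    refine Finset.eq_of_subset_of_card_le (fun j hj => ?_) hcard.ge
    by_contra hj'
    have h1 := abs_lt.1 (hz.1 j hj)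
    have h2 := hz'.2 j hj'
    rw [← hcard] at h2
    have h3 : ((p' j : ℤ) : ℝ) < p j := by linarith
    have h4 : ((p j : ℤ) : ℝ) < p' j + 1 := by linarith
    have h3' : p' j < p j := by exact_mod_cast h3
    have h4' : p j < p' j + 1 := by exact_mod_cast h4
    omega
  subst hT
  refine ⟨rfl, funext fun j => ?_⟩
  have h34 : ((p' j : ℤ) : ℝ) < p j + 1 ∧ ((p j : ℤ) : ℝ) < p' j + 1 := by
    by_cases hj : j ∈ T
    · have h1 := abs_lt.1 (hz.1 j hj)
      have h2 := abs_lt.1 (hz'.1 j hj)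
      constructor <;> linarith
    · have h1 := hz.2 j hj
      have h2 := hz'.2 j hj
      constructor <;> linarith
  have h3' : p' j < p j + 1 := by exact_mod_cast h34.1
  have h4' : p j < p' j + 1 := by exact_mod_cast h34.2
  omega

/-- Cells with at least one fixed coordinate cover the points having an integer coordinate. -/
theorem exists_mem_gridCell {d : ℕ} (z : Fin d → ℝ) (hz : ∃ j, ∃ q : ℤ, z j = q) :
    ∃ (T : Finset (Fin d)) (p : Fin d → ℤ), T.Nonempty ∧ z ∈ gridCell T p := by
  classical
  let a : ℕ → Finset (Fin d) := fun c => {j | |z j - round (z j)| < gridRadius d c}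
  let b : ℕ → Finset (Fin d) := fun c => {j | |z j - round (z j)| ≤ gridRadius d c}
  have hab : ∀ c, a c ⊆ b c := fun c j hj => by
    simp only [a, b, Finset.mem_filter, Finset.mem_univ, true_and] at hj ⊢
    exact hj.le
  have hba : ∀ c, b c ⊆ a (c + 1) := fun c j hj => by
    simp only [a, b, Finset.mem_filter, Finset.mem_univ, true_and] at hj ⊢
    exact hj.trans_lt (gridRadius_lt_succ d c)
  -- the numbers `(b c).card ≤ d` cannot all exceed `c`
  obtain ⟨c, hac, hbc⟩ : ∃ c, (a (c + 1)).card = c + 1 ∧ (b (c + 1)).card = c + 1 := by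
    by_contra! hne
    have hb : ∀ c, c + 1 ≤ (b c).card := by
      intro c
      induction c with
      | zero =>
        obtain ⟨j, q, hq⟩ := hz
        refine Finset.card_pos.2 ⟨j, ?_⟩
        simp only [b, Finset.mem_filter, Finset.mem_univ, true_and, hq, round_intCast, sub_self,
          abs_zero]
        exact (gridRadius_pos d 0).le
      | succ c ih =>
        have h1 := Finset.card_le_card (hba c)
        have h2 := Finset.card_le_card (hab (c + 1))
        have h3 := hne c
        omega
    have h1 := hb d
    have h2 : (b d).card ≤ d := by simpa using (b d).card_le_univ
    omega
  have heq : a (c + 1) = b (c + 1) := Finset.eq_of_subset_of_card_le (hab _) (by omega)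
  refine ⟨a (c + 1), fun j => if j ∈ a (c + 1) then round (z j) else ⌊z j⌋,
    Finset.card_pos.1 (by omega), fun j hj => ?_, fun j hj => ?_⟩
  · simp only [hj, if_true, hac]
    simpa [a] using hj
  · have hj' : gridRadius d (c + 1) < |z j - round (z j)| := by
      rw [heq] at hj
      simpa [b] using hj
    rw [abs_sub_round_eq_min, lt_min_iff] at hj'
    simp only [hj, if_false, hac]
    have := Int.self_sub_floor (z j)
    constructor <;> linarith [hj'.1, hj'.2]

theorem hasShrinkingsOfOrderLE_sphere_pi (k : ℕ) :
    HasShrinkingsOfOrderLE (sphere (0 : Fin (k + 1) → ℝ) 1) k := by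
  classical
  intro ι V₀ hV₀ hc₀
  obtain ⟨V, hV, hc, hVlf, hVV₀⟩ := precise_refinement V₀ hV₀ hc₀
  obtain ⟨δ, hδ, hball⟩ := lebesgue_number_lemma_of_metric isCompact_univ hV hc.ge
  obtain ⟨M, hM⟩ := exists_nat_gt (1 / δ)
  have hM0 : 0 < (M : ℝ) := (by positivity : 0 < 1 / δ).trans hM
  let z : sphere (0 : Fin (k + 1) → ℝ) 1 → Fin (k + 1) → ℝ := fun y j => M * (y : Fin (k + 1) → ℝ) j
  have hz : Continuous z := continuous_pi fun j =>
    continuous_const.mul ((continuous_apply j).comp continuous_subtype_val)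
  let I := {c : Finset (Fin (k + 1)) × (Fin (k + 1) → ℤ) //
    c.1.Nonempty ∧ ∃ y, z y ∈ gridCell c.1 c.2}
  have hI : ∀ c : I, ∃ i, z ⁻¹' gridCell c.1.1 c.1.2 ⊆ V i := by
    rintro ⟨⟨T, p⟩, -, y, hy⟩
    obtain ⟨i, hi⟩ := hball y (mem_univ y)
    refine ⟨i, fun y' hy' => hi ?_⟩
    rw [mem_ball, Subtype.dist_eq, dist_pi_lt_iff hδ]
    intro j
    have h1 := abs_sub_lt_one_of_mem_gridCell hy' hy j
    simp only [z] at h1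
    rw [← mul_sub, abs_mul, abs_of_pos hM0] at h1
    rw [Real.dist_eq]
    rw [div_lt_iff₀ hδ] at hM
    exact lt_of_mul_lt_mul_left (h1.trans hM) hM0.le
  choose i hi using hI
  let W : ι → Set (sphere (0 : Fin (k + 1) → ℝ) 1) := fun s =>
    ⋃ c : {c : I // i c = s}, z ⁻¹' gridCell c.1.1.1 c.1.1.2
  have hWV : ∀ s, W s ⊆ V s := fun s => iUnion_subset fun c => (hi c.1).trans (by rw [c.2])
  refine ⟨W, fun s => isOpen_iUnion fun c => (isOpen_gridCell _ _).preimage hz, ?_,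
    fun s => (hWV s).trans (hVV₀ s), hVlf.subset hWV, fun y σ hσ => ?_⟩
  · refine eq_univ_of_forall fun y => ?_
    have hint : ∃ j, ∃ q : ℤ, z y j = q := by
      have hy : ‖(y : Fin (k + 1) → ℝ)‖ = 1 := by simp
      obtain ⟨j, -, hj⟩ := Finset.exists_mem_eq_sup (Finset.univ : Finset (Fin (k + 1)))
        Finset.univ_nonempty fun j => ‖(y : Fin (k + 1) → ℝ) j‖₊
      have hj' : |(y : Fin (k + 1) → ℝ) j| = 1 := by
        refine Eq.trans ?_ hy
        rw [Pi.norm_def, hj]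
        rfl
      rcases (abs_eq zero_le_one).1 hj' with h | h
      · exact ⟨j, M, by simp [z, h]⟩
      · exact ⟨j, -M, by simp [z, h]⟩
    obtain ⟨T, p, hT, hmem⟩ := exists_mem_gridCell (z y) hint
    exact mem_iUnion.2 ⟨i ⟨(T, p), hT, y, hmem⟩, mem_iUnion.2 ⟨⟨_, rfl⟩, hmem⟩⟩
  · have hx : ∀ s : σ, ∃ c : I, i c = s ∧ z y ∈ gridCell c.1.1 c.1.2 := by
      rintro ⟨s, hs⟩
      obtain ⟨c, hc⟩ := mem_iUnion.1 (hσ s hs)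
      exact ⟨c.1, c.2, hc⟩
    choose c hcs hcy using hx
    have hinj : Function.Injective fun s : σ => (c s).1.1.card := by
      intro s t hst
      obtain ⟨h1, h2⟩ := gridCell_eq_of_mem (hcy s) (hcy t) hst
      have : c s = c t := Subtype.ext (Prod.ext h1 h2)
      exact Subtype.ext (by rw [← hcs s, ← hcs t, this])
    have hsub : Finset.univ.image (fun s : σ => (c s).1.1.card) ⊆ Finset.Icc 1 (k + 1) := by
      intro n hn
      obtain ⟨s, -, rfl⟩ := Finset.mem_image.1 hn
      exact Finset.mem_Icc.2 ⟨Finset.card_pos.2 (c s).2.1, by simpa using (c s).1.1.card_le_univ⟩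
    have := Finset.card_le_card hsub
    rwa [Finset.card_image_of_injective _ hinj, Finset.card_univ, Fintype.card_coe, Nat.card_Icc,
      Nat.add_sub_cancel] at this

/-- Radial projection between the Euclidean unit sphere and the boundary of the cube. -/
noncomputable def sphereHomeomorphSpherePi (d : ℕ) :
    sphere (0 : EuclideanSpace ℝ (Fin d)) 1 ≃ₜ sphere (0 : Fin d → ℝ) 1 where
  toFun x := ⟨‖x.1.ofLp‖⁻¹ • x.1.ofLp, by
    have : x.1.ofLp ≠ 0 := fun h => by
      have := ne_zero_of_mem_unit_sphere x
      exact this (by ext j; simpa using congrFun h j)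
    simp [norm_smul, norm_ne_zero_iff.2 this]⟩
  invFun y := ⟨‖WithLp.toLp 2 y.1‖⁻¹ • WithLp.toLp 2 y.1, by
    have : WithLp.toLp 2 y.1 ≠ 0 := fun h => by
      have := ne_zero_of_mem_unit_sphere y
      exact this (by ext j; simpa using congrArg (fun v => v.ofLp j) h)
    simp [norm_smul, norm_ne_zero_iff.2 this]⟩
  left_inv x := by
    have hx : x.1.ofLp ≠ 0 := fun h => by
      have := ne_zero_of_mem_unit_sphere x
      exact this (by ext j; simpa using congrFun h j)
    have h1 : ‖x.1‖ = 1 := by simp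
    refine Subtype.ext ?_
    have h2 := norm_ne_zero_iff.2 hx
    simp [norm_smul, h1, smul_smul, h2]
  right_inv y := by
    have hy : WithLp.toLp 2 y.1 ≠ 0 := fun h => by
      have := ne_zero_of_mem_unit_sphere y
      exact this (by ext j; simpa using congrArg (fun v => v.ofLp j) h)
    have h1 : ‖y.1‖ = 1 := by simp
    have h2 := norm_ne_zero_iff.2 hy
    refine Subtype.ext ?_
    simp [norm_smul, h1, smul_smul, h2]
  continuous_toFun := by
    have hc : Continuous fun x : sphere (0 : EuclideanSpace ℝ (Fin d)) 1 => x.1.ofLp := by fun_prop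
    refine Continuous.subtype_mk (Continuous.smul (hc.norm.inv₀ fun x h => ?_) hc) _
    have := ne_zero_of_mem_unit_sphere x
    exact this (by ext j; simpa using congrFun (norm_eq_zero.1 h) j)
  continuous_invFun := by
    have hc : Continuous fun y : sphere (0 : Fin d → ℝ) 1 => WithLp.toLp 2 y.1 := by fun_prop
    refine Continuous.subtype_mk (Continuous.smul (hc.norm.inv₀ fun y h => ?_) hc) _
    have := ne_zero_of_mem_unit_sphere y
    exact this (by ext j; simpa using congrArg (fun v => v.ofLp j) (norm_eq_zero.1 h))

/-- The `k`-sphere has dimension at most `k`: the boundary of a cube in `ℝ^(k+1)` has fine covers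
by grid cells in which the number of fixed coordinates takes only the `k + 1` values
`1, …, k + 1`. -/
theorem hasShrinkingsOfOrderLE_sphere (k : ℕ) :
    HasShrinkingsOfOrderLE (sphere (0 : EuclideanSpace ℝ (Fin (k + 1))) 1) k :=
  (hasShrinkingsOfOrderLE_sphere_pi k).of_homeomorph (sphereHomeomorphSpherePi (k + 1))

/-! ### Asphericity of neighbourhoods in a uniformly equi-`LC^n` family -/

/-- A finite sequence of positive numbers chosen backwards from its last term `ε`. -/
theorem exists_backward_seq (N : ℕ) (P : ℕ → ℝ → ℝ → Prop)
    (h : ∀ i < N, ∀ r > 0, ∃ ρ > 0, P i ρ r) {ε : ℝ} (hε : 0 < ε) :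
    ∃ R : ℕ → ℝ, (∀ i ≤ N, 0 < R i) ∧ R N = ε ∧ ∀ i < N, P i (R i) (R (i + 1)) := by
  induction N generalizing P with
  | zero => exact ⟨fun _ => ε, fun _ _ => hε, rfl, fun i hi => absurd hi (Nat.not_lt_zero i)⟩
  | succ N ih =>
    obtain ⟨R, hpos, hlast, hP⟩ := ih (fun i => P (i + 1)) fun i hi => h (i + 1) (by omega)
    obtain ⟨ρ, hρ, hPρ⟩ := h 0 (Nat.succ_pos N) (R 0) (hpos 0 (Nat.zero_le N))
    refine ⟨fun i => Nat.casesOn i ρ R, ?_, hlast, ?_⟩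
    · rintro (_ | i) hi
      exacts [hρ, hpos i (by omega)]
    · rintro (_ | i) hi
      exacts [hPρ, hP i (by omega)]

theorem UniformlyEquiLC.exists_sphereExtends_subtype {E : Type*} [MetricSpace E] {n : ℤ}
    {𝒮 : Set (Set E)} (h𝒮 : UniformlyEquiLC n 𝒮) {r : ℝ} (hr : 0 < r) :
    ∃ ρ > 0, ρ ≤ r ∧ ∀ S ∈ 𝒮, ∀ j : ℕ, ((j + 1 : ℕ) : ℤ) ≤ n + 1 → ∀ c : E,
      SphereExtends (j + 1) {y : S | dist (y : E) c < ρ} {y : S | dist (y : E) c < r} := by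
  obtain ⟨δ, hδ, h⟩ := h𝒮 (r / 2) (half_pos hr)
  refine ⟨min (δ / 3) (r / 2), by positivity, (min_le_right _ _).trans (by linarith), ?_⟩
  intro S hS j hj c f hf
  have hf1 : ∀ s, dist (f s : E) c < δ / 3 := fun s => (hf s).trans_le (min_le_left _ _)
  have hf2 : ∀ s, dist (f s : E) c < r / 2 := fun s => (hf s).trans_le (min_le_right _ _)
  obtain ⟨H, hext, hdiam⟩ := h S hS (j + 1) hj f (by
    have hle : diam (range fun s => (f s : E)) ≤ 2 * (δ / 3) := by
      refine diam_le_of_forall_dist_le (by positivity) ?_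
      rintro _ ⟨s, rfl⟩ _ ⟨t, rfl⟩
      have := dist_triangle_right (f s : E) (f t) c
      linarith [hf1 s, hf1 t]
    linarith)
  refine ⟨H, hext, fun b => ?_⟩
  obtain ⟨s⟩ : Nonempty (sphere (0 : EuclideanSpace ℝ (Fin (j + 1))) 1) :=
    (NormedSpace.sphere_nonempty.2 zero_le_one).to_subtype
  have hbdd : Bornology.IsBounded (range fun b => (H b : E)) :=
    (isCompact_range (continuous_subtype_val.comp H.continuous)).isBounded
  have h1 : dist (H b : E) (f s) < r / 2 := by
    rw [← hext s]
    exact (dist_le_diam_of_mem hbdd (mem_range_self b) (mem_range_self _)).trans_lt hdiam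
  calc dist (H b : E) c ≤ dist (H b : E) (f s) + dist (f s : E) c := dist_triangle _ _ _
    _ < r / 2 + r / 2 := add_lt_add h1 (hf2 s)
    _ = r := add_halves r

/-- Maps of a sphere into a small neighbourhood of a member `S` of the family are uniformly close
to maps into `S`. This is the selection theorem on the sphere, applied to balls in `S`. -/
theorem UniformlyEquiLC.exists_approx_on_sphere {E : Type*} [MetricSpace E] {n : ℤ}
    {𝒮 : Set (Set E)} (h𝒮 : UniformlyEquiLC n 𝒮) {j : ℕ} (hj : ((j + 1 : ℕ) : ℤ) ≤ n + 1)
    {ε : ℝ} (hε : 0 < ε) :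
    ∃ ν > 0, ∀ S ∈ 𝒮, ∀ f : C(sphere (0 : EuclideanSpace ℝ (Fin (j + 1))) 1, E),
      (∀ s, f s ∈ thickening ν S) →
      ∃ h : C(sphere (0 : EuclideanSpace ℝ (Fin (j + 1))) 1, S),
        ∀ s, dist (h s : E) (f s) < ε := by
  obtain ⟨R, hpos, hlast, hR⟩ := exists_backward_seq j
    (fun i ρ r => ρ ≤ r ∧ ∀ S ∈ 𝒮, ∀ i : ℕ, ((i + 1 : ℕ) : ℤ) ≤ n + 1 → ∀ c : E,
      SphereExtends (i + 1) {y : S | dist (y : E) c < ρ} {y : S | dist (y : E) c < r})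
    (fun i _ r hr => h𝒮.exists_sphereExtends_subtype hr) hε
  refine ⟨R 0, hpos 0 (Nat.zero_le j), fun S hS f hf => ?_⟩
  obtain ⟨h, hh, hmem⟩ := exists_continuous_selection (hasShrinkingsOfOrderLE_sphere j)
    (fun i x => {y : S | dist (y : E) (f x) < R i})
    (fun i => isOpen_lt (f := fun p : _ × S => dist (p.2 : E) (f p.1)) (by fun_prop)
      continuous_const)
    (fun x => by
      obtain ⟨z, hz, hd⟩ := mem_thickening_iff.1 (hf x)
      exact ⟨⟨z, hz⟩, by rw [dist_comm] at hd; exact hd⟩)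
    (fun i hi x y hy => lt_of_lt_of_le hy (hR i hi).1)
    (fun i hi x => (hR i hi).2 S hS i (by push_cast at hj ⊢; omega) (f x))
  exact ⟨⟨h, hh⟩, fun s => hlast ▸ hmem s⟩

/-- The radial extension of a map of the unit sphere into a normed space. -/
theorem exists_radial_extension {V E : Type*} [NormedAddCommGroup V] [NormedSpace ℝ V]
    [NormedAddCommGroup E] [NormedSpace ℝ E] {ε : ℝ} (hε : 0 < ε) (g : C(sphere (0 : V) 1, E))
    (hg : ∀ s, ‖g s‖ < ε) :
    ∃ G : C(closedBall (0 : V) 1, E),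
      (∀ s : sphere (0 : V) 1, G ⟨s, sphere_subset_closedBall s.2⟩ = g s) ∧ ∀ b, ‖G b‖ < ε := by
  classical
  let g' : V → E := fun v => if hv : v ∈ sphere (0 : V) 1 then g ⟨v, hv⟩ else 0
  have hg' : ∀ s : sphere (0 : V) 1, g' s = g s := fun s => dif_pos s.2
  have hg'c : ContinuousOn g' (sphere 0 1) := by
    rw [continuousOn_iff_continuous_domRestrict]
    exact g.continuous.congr fun s => (hg' s).symm
  have hg'n : ∀ v, ‖g' v‖ < ε := by
    intro v
    by_cases hv : v ∈ sphere (0 : V) 1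
    · rw [hg' ⟨v, hv⟩]; exact hg _
    · simp only [g', dif_neg hv, norm_zero, hε]
  let G : V → E := fun v => ‖v‖ • g' (‖v‖⁻¹ • v)
  have hGle : ∀ v, ‖G v‖ ≤ ‖v‖ * ε := fun v => by
    rw [norm_smul, norm_norm]
    exact mul_le_mul_of_nonneg_left (hg'n _).le (norm_nonneg v)
  have hG : Continuous G := by
    refine continuous_iff_continuousAt.2 fun v => ?_
    by_cases hv : v = 0
    · subst hv
      have h0 : G 0 = 0 := by simp [G]
      rw [ContinuousAt, h0]
      refine squeeze_zero_norm hGle ?_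
      have : Continuous fun v : V => ‖v‖ * ε := by fun_prop
      simpa using this.tendsto 0
    · have hon : ContinuousOn G {0}ᶜ := by
        have hinv : ContinuousOn (fun v : V => ‖v‖⁻¹ • v) {0}ᶜ :=
          (continuous_norm.continuousOn.inv₀ fun w hw => norm_ne_zero_iff.2 hw).smul
            continuousOn_id
        refine continuous_norm.continuousOn.smul (hg'c.comp hinv fun w hw => ?_)
        have : ‖w‖ ≠ 0 := norm_ne_zero_iff.2 hw
        simp [norm_smul, this]
      exact hon.continuousAt (isOpen_compl_singleton.mem_nhds hv)
  refine ⟨⟨fun b => G b, hG.comp continuous_subtype_val⟩, fun s => ?_, fun b => ?_⟩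
  · have hs : ‖(s : V)‖ = 1 := by simp
    simp [G, hs, hg' s]
  · have hb : ‖(b : V)‖ ≤ 1 := mem_closedBall_zero_iff.1 b.2
    calc ‖G b‖ = ‖(b : V)‖ * ‖g' (‖(b : V)‖⁻¹ • (b : V))‖ := by
          simp only [G, norm_smul, norm_norm]
      _ ≤ 1 * ‖g' (‖(b : V)‖⁻¹ • (b : V))‖ := mul_le_mul_of_nonneg_right hb (norm_nonneg _)
      _ < ε := by rw [one_mul]; exact hg'n _

/-- Small spheres near a member `S` of the family bound small balls near `S`. The size `ρ` of the
spheres does not depend on the width `μ` of the neighbourhood in which the balls have to lie.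
A sphere near `S` is approximated by one in `S`; a ball bounded by the latter is corrected by the
radial extension of the difference. -/
theorem UniformlyEquiLC.exists_sphereExtends_thickening {E : Type*} [NormedAddCommGroup E]
    [NormedSpace ℝ E] {n : ℤ} {𝒮 : Set (Set E)} (h𝒮 : UniformlyEquiLC n 𝒮) {r : ℝ}
    (hr : 0 < r) :
    ∃ ρ > 0, ρ ≤ r ∧ ∀ j : ℕ, ((j + 1 : ℕ) : ℤ) ≤ n + 1 → ∀ μ > 0, ∃ ν > 0, ν ≤ μ ∧
      ∀ S ∈ 𝒮, ∀ c : E,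
        SphereExtends (j + 1) (thickening ν S ∩ ball c ρ) (thickening μ S ∩ ball c r) := by
  obtain ⟨δ, hδ, hLC⟩ := h𝒮 (r / 2) (half_pos hr)
  obtain ⟨ρ, hρ, hρδ, hρr⟩ : ∃ ρ > 0, 5 * ρ ≤ δ ∧ 8 * ρ ≤ r :=
    ⟨min (δ / 5) (r / 8), by positivity, by linarith [min_le_left (δ / 5) (r / 8)],
      by linarith [min_le_right (δ / 5) (r / 8)]⟩
  refine ⟨ρ, hρ, by linarith, fun j hj μ hμ => ?_⟩
  obtain ⟨ε, hε, hεμ, hερ⟩ : ∃ ε > 0, ε ≤ μ ∧ ε ≤ ρ :=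
    ⟨min μ ρ, by positivity, min_le_left _ _, min_le_right _ _⟩
  obtain ⟨ν, hν, happ⟩ := h𝒮.exists_approx_on_sphere hj hε
  refine ⟨min ν μ, by positivity, min_le_right _ _, fun S hS c f hf => ?_⟩
  obtain ⟨h, hh⟩ := happ S hS f fun s => thickening_mono (min_le_left _ _) _ (hf s).1
  have hhc : ∀ s, dist (h s : E) c < 2 * ρ := fun s => by
    have h1 : dist (f s) c < ρ := (hf s).2
    linarith [dist_triangle (h s : E) (f s) c, hh s]
  obtain ⟨H, hext, hdiam⟩ := hLC S hS (j + 1) hj h (by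
    have hle : diam (range fun s => (h s : E)) ≤ 4 * ρ := by
      refine diam_le_of_forall_dist_le (by positivity) ?_
      rintro _ ⟨s, rfl⟩ _ ⟨t, rfl⟩
      have := dist_triangle_right (h s : E) (h t) c
      linarith [hhc s, hhc t]
    linarith)
  obtain ⟨G, hGext, hG⟩ := exists_radial_extension hε
    (⟨fun s => f s - h s, by fun_prop⟩ :
      C(sphere (0 : EuclideanSpace ℝ (Fin (j + 1))) 1, E))
    (fun s => by
      have := hh s
      rw [dist_comm, dist_eq_norm] at this
      exact this)
  refine ⟨⟨fun b => (H b : E) + G b, by fun_prop⟩, fun s => ?_, fun b => ⟨?_, ?_⟩⟩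
  · have h1 := hext s
    have h2 := hGext s
    simp only [ContinuousMap.coe_mk] at h2 ⊢
    rw [h1, h2]
    abel
  · refine mem_thickening_iff.2 ⟨H b, (H b).2, ?_⟩
    simpa [dist_eq_norm] using (hG b).trans_le hεμ
  · obtain ⟨s⟩ : Nonempty (sphere (0 : EuclideanSpace ℝ (Fin (j + 1))) 1) :=
      (NormedSpace.sphere_nonempty.2 zero_le_one).to_subtype
    have hbdd : Bornology.IsBounded (range fun b => (H b : E)) :=
      (isCompact_range (continuous_subtype_val.comp H.continuous)).isBounded
    have h1 : dist (H b : E) (h s) < r / 2 := by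
      rw [← hext s]
      exact (dist_le_diam_of_mem hbdd (mem_range_self b) (mem_range_self _)).trans_lt hdiam
    have h2 : dist ((H b : E) + G b) (H b) < ε := by simpa [dist_eq_norm] using hG b
    have h3 := dist_triangle ((H b : E) + G b) (H b) c
    have h4 := dist_triangle (H b : E) (h s) c
    simp only [ContinuousMap.coe_mk, mem_ball]
    linarith [hhc s]

/-! ### Approximate selections and their limit -/

theorem LowerHemicontinuous.isOpen_thickening_graph {X E : Type*} [TopologicalSpace X]
    [MetricSpace E] {Φ : X → Set E} (hΦ : LowerHemicontinuous Φ) (ν : ℝ) :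
    IsOpen {p : X × E | p.2 ∈ thickening ν (Φ p.1)} := by
  rw [isOpen_iff_mem_nhds]
  rintro ⟨x, y⟩ hy
  obtain ⟨z, hz, hd⟩ := mem_thickening_iff.1 hy
  obtain ⟨η, hη, hην⟩ : ∃ η > 0, dist y z + 2 * η ≤ ν :=
    ⟨(ν - dist y z) / 2, by linarith, by linarith⟩
  have hx := lowerHemicontinuousAt_iff.1 (lowerHemicontinuous_iff.1 hΦ x) (ball z η) isOpen_ball
    ⟨z, hz, mem_ball_self hη⟩
  filter_upwards [prod_mem_nhds hx (ball_mem_nhds y hη)]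
  rintro ⟨x', y'⟩ ⟨⟨z', hz', hzz'⟩, hy'⟩
  refine mem_thickening_iff.2 ⟨z', hz', ?_⟩
  have h1 := dist_triangle4 y' y z z'
  have h2 : dist y' y < η := hy'
  have h3 : dist z z' < η := by rw [dist_comm]; exact hzz'
  linarith

/-- A `δ`-selection can be improved to a `μ`-selection, for any `μ`, by moving it less than `ε`. -/
theorem UniformlyEquiLC.exists_improved_selection.{u, v} {E : Type v} [NormedAddCommGroup E]
    [NormedSpace ℝ E] {n : ℤ} {𝒮 : Set (Set E)} (h𝒮 : UniformlyEquiLC n 𝒮) {N : ℕ}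
    (hN : (N : ℤ) = n + 1) {ε : ℝ} (hε : 0 < ε) :
    ∃ δ > 0, ∀ μ > 0, ∀ (X : Type u) [TopologicalSpace X] [T2Space X] [ParacompactSpace X],
      HasShrinkingsOfOrderLE X N → ∀ Φ : X → Set E, (∀ x, Φ x ∈ 𝒮) → LowerHemicontinuous Φ →
      ∀ g : X → E, Continuous g → IsEpsSelection δ g Φ →
        ∃ f : X → E, Continuous f ∧ IsEpsSelection μ f Φ ∧ ∀ x, dist (g x) (f x) < ε := by
  obtain ⟨R, hRpos, hRlast, hR⟩ := exists_backward_seq N _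
    (fun i _ r hr => h𝒮.exists_sphereExtends_thickening hr) hε
  refine ⟨R 0, hRpos 0 (Nat.zero_le N), ?_⟩
  intro μ hμ X _ _ _ hX Φ hΦ𝒮 hΦ g hg hgΦ
  obtain ⟨ν, hνpos, hνlast, hν⟩ := exists_backward_seq N
    (fun i ν ν' => ν ≤ ν' ∧ ∀ S ∈ 𝒮, ∀ c : E, SphereExtends (i + 1)
      (thickening ν S ∩ ball c (R i)) (thickening ν' S ∩ ball c (R (i + 1))))
    (fun i hi ν' hν' => (hR i hi).2 i (by push_cast; omega) ν' hν') hμ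
  obtain ⟨f, hf, hmem⟩ := exists_continuous_selection hX
    (fun i x => thickening (ν i) (Φ x) ∩ ball (g x) (R i))
    (fun i => (hΦ.isOpen_thickening_graph (ν i)).inter
      (isOpen_lt (f := fun p : X × E => dist p.2 (g p.1)) (by fun_prop) continuous_const))
    (fun x => by
      obtain ⟨z, hz, hd⟩ := mem_thickening_iff.1 (hgΦ x)
      exact ⟨z, self_subset_thickening (hνpos 0 (Nat.zero_le N)) _ hz, by
        rw [mem_ball, dist_comm]; exact hd⟩)
    (fun i hi x => inter_subset_inter (thickening_mono (hν i hi).1 _)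
      (ball_subset_ball (hR i hi).1))
    (fun i hi x => (hν i hi).2 _ (hΦ𝒮 x) (g x))
  refine ⟨f, hf, fun x => hνlast ▸ (hmem x).1, fun x => ?_⟩
  have := (hmem x).2
  rwa [hRlast, mem_ball, dist_comm] at this

theorem theorem5p3 (n : ℤ) (hn : -1 ≤ n)
    (E : Type*) [NormedAddCommGroup E] [NormedSpace ℝ E] [CompleteSpace E]
    (𝒮 : Set (Set E)) (h𝒮 : UniformlyEquiLC n 𝒮) :
    ∃ γ : ℝ → ℝ, (∀ ε : ℝ, 0 < ε → 0 < γ ε) ∧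
      ∀ (X : Type*) [TopologicalSpace X] [T2Space X] [ParacompactSpace X],
        CoveringDimLE X (n + 1) →
        ∀ Φ : X → Set E, (∀ x, Φ x ∈ 𝒮) → LowerHemicontinuous Φ →
        ∀ ε : ℝ, 0 < ε →
        ∀ g : X → E, Continuous g → IsEpsSelection (γ ε) g Φ →
          ∃ f : X → E, Continuous f ∧
            IsSelection f (fun x => closure (Φ x) ∩ ball (g x) ε) := by
  obtain ⟨N, hN⟩ : ∃ N : ℕ, (N : ℤ) = n + 1 := ⟨(n + 1).toNat, Int.toNat_of_nonneg (by omega)⟩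
  have himp := fun (ε : ℝ) (hε : 0 < ε) => h𝒮.exists_improved_selection hN hε
  choose! δ hδ himp using himp
  -- the `i`-th step moves the selection by less than `η ε i`; these numbers add up to `ε / 2`
  let η : ℝ → ℕ → ℝ := fun ε i => ε / 2 / 2 / 2 ^ i
  have hη : ∀ {ε : ℝ}, 0 < ε → ∀ i, 0 < η ε i := fun hε i => by positivity
  let d : ℝ → ℕ → ℝ := fun ε i => min (δ (η ε i)) (η ε i)
  have hd : ∀ {ε : ℝ}, 0 < ε → ∀ i, 0 < d ε i := fun hε i =>
    lt_min (hδ _ (hη hε i)) (hη hε i)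
  refine ⟨fun ε => d ε 0, fun ε hε => hd hε 0, ?_⟩
  intro X _ _ _ hX Φ hΦ𝒮 hΦ ε hε g hg hgΦ
  rw [← hN] at hX
  have step : ∀ (i : ℕ) (p : {p : X → E // Continuous p ∧ IsEpsSelection (d ε i) p Φ}),
      ∃ q : {q : X → E // Continuous q ∧ IsEpsSelection (d ε (i + 1)) q Φ},
        ∀ x, dist (p.1 x) (q.1 x) < η ε i := by
    rintro i ⟨p, hp, hpΦ⟩
    obtain ⟨q, hq, hqΦ, hpq⟩ := himp (η ε i) (hη hε i) (d ε (i + 1)) (hd hε _) X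
      hX.hasShrinkingsOfOrderLE Φ hΦ𝒮 hΦ p hp
      fun x => thickening_mono (min_le_left _ _) _ (hpΦ x)
    exact ⟨⟨q, hq, hqΦ⟩, hpq⟩
  choose next hnext using step
  let G : ∀ i, {p : X → E // Continuous p ∧ IsEpsSelection (d ε i) p Φ} :=
    fun i => Nat.rec ⟨g, hg, hgΦ⟩ (fun i p => next i p) i
  have hG : ∀ x i, dist ((G i).1 x) ((G (i + 1)).1 x) ≤ ε / 2 / 2 / 2 ^ i :=
    fun x i => (hnext i (G i) x).le
  choose f hf using fun x => cauchySeq_tendsto_of_complete (cauchySeq_of_le_geometric_two (hG x))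
  have hGf : ∀ x i, dist ((G i).1 x) (f x) ≤ ε / 2 / 2 ^ i := fun x i =>
    dist_le_of_le_geometric_two_of_tendsto (hG x) (hf x) i
  have hlim : Filter.Tendsto (fun i : ℕ => ε / 2 / 2 ^ i) Filter.atTop (nhds 0) :=
    tendsto_const_nhds.div_atTop (tendsto_pow_atTop_atTop_of_one_lt one_lt_two)
  have hunif : TendstoUniformly (fun i => (G i).1) f Filter.atTop := by
    rw [Metric.tendstoUniformly_iff]
    intro κ hκ
    filter_upwards [hlim.eventually (gt_mem_nhds hκ)] with i hi x
    rw [dist_comm]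
    exact (hGf x i).trans_lt hi
  refine ⟨f, hunif.continuous (Filter.Frequently.of_forall fun i => (G i).2.1), fun x =>
    ⟨Metric.mem_closure_iff.2 fun κ hκ => ?_, ?_⟩⟩
  · obtain ⟨i, hi⟩ := (hlim.eventually (gt_mem_nhds (half_pos hκ))).exists
    obtain ⟨z, hz, hdz⟩ := mem_thickening_iff.1 ((G i).2.2 x)
    refine ⟨z, hz, ?_⟩
    have h1 : d ε i ≤ ε / 2 / 2 ^ i := (min_le_right _ _).trans
      (div_le_div_of_nonneg_right (by linarith) (by positivity))
    linarith [dist_triangle_left (f x) z ((G i).1 x), hGf x i]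
  · have h0 := hGf x 0
    rw [pow_zero, div_one, dist_comm] at h0
    exact lt_of_le_of_lt h0 (half_lt_self hε)
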